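/- **Signals and systems.** Fix the time axis $\mathbb T=\mathbb R_{\ge 0}$ (Lebesgue measure) or $\mathbb T=\mathbb N_0$ (counting measure). $\mathbf L_2^r$ is the Hilbert space of finite-energy signals $\mathbb T\to\mathbb R^r$, and $\mathbf L_{2e}^r$ is the space of measurable signals $v$ whose truncations $\boldsymbol\pi_\tau v$ (equal to $v$ on $[0,\tau)$, resp. $\{0,\dots,\tau\}$, and $0$ elsewhere) lie in $\mathbf L_2^r$ for all $\tau\in\mathbb T$. A *system* is a map $G:\mathbf L_{2e}^q\to\mathbf L_{2e}^r$ with $\boldsymbol\pi_\tau G(u)=\boldsymbol\pi_\tau G(\boldsymbol\pi_\tau u)$ for all $\tau,u$, and $G(0)=0$; it is *stable* if there is $\gamma>0$ with $\|G(u)\|\le\gamma\|u\|$ for all $u\in\mathbf L_2^q$. The interconnection $[\![G,\varDelta]\!]:(d_y,d_u)\mapsto(y,u)$, given by $y=G(u)+d_y$, $u=\varDelta(y)+d_u$, is *well-posed* if a unique solution exists in the extended spaces for all $d_y,d_u$ and the map is causal; it is *stable* if it is moreover bounded. Matrices act by pointwise multiplication, and $A^*$ is the Hilbert adjoint. **Network.**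 Let $\mathscr G=(\mathcal V,\mathscr E)$ be a connected simple graph, $\mathcal V=\{1,\dots,n\}$, $n\ge2$, $m=|\mathscr E|$. Let $\mathcal N_i$ be the set of neighbours and $\mathscr E_i$ the set of edges at $i$, $m_i=|\mathcal N_i|$; index the coordinates of $\mathbf L_{2e}^{m_i}$ by $\mathcal N_i$ and those of $\mathbf L_{2e}^{2m}$ by the pairs $(i,j)$ with $j\in\mathcal N_i$. Let $H_i:\mathbf L_{2e}^{m_i}\to\mathbf L_{2e}$ be linear systems and $\varLambda_{i,j}:\mathbf L_{2e}\to\mathbf L_{2e}$ ($j\in\mathcal N_i$) stable, possibly nonlinear, systems. Put $H=\bigoplus_i H_i$, $\varLambda=\bigoplus_i\bigoplus_{j\in\mathcal N_i}\varLambda_{i,j}$, $T=\bigoplus_i\mathbf 1_{m_i,1}$, and let $P$ be the permutation matrix with $(Pv)_{(i,j)}=v_{(j,i)}$. Assume that $[\![P,TH]\!]$ is stable. Put $G=H(P-TH)^{-1}$, $\varDelta=(\varLambda-I)\circ T$ and $\varDelta_i=(\bigoplus_{j\in\mathcal N_i}\varLambda_{i,j}-I)\circ\mathbf 1_{m_i,1}$,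 and assume that $[\![G,\alpha\varDelta]\!]$ is well-posed for every $\alpha\in[0,1]$. **Coprime factors and multipliers.** Let $H_i=N_iD_i^{-1}$ with $D_i$ bijective on $\mathbf L_{2e}^{m_i}$ and $U_iN_i+V_iD_i=I$, where $N_i,D_i,U_i,V_i$ are stable linear systems. Let $\varPi_i=\begin{bmatrix}\varPi_{1,i}&\varPi_{2,i}\\ \varPi_{2,i}^*&\varPi_{3,i}\end{bmatrix}$ be a bounded self-adjoint operator on $\mathbf L_2\times\mathbf L_2^{m_i}$ such that $\langle(y_i,u_i),\varPi_i(y_i,u_i)\rangle\ge0$ whenever $y_i\in\mathbf L_2$, $\alpha\in[0,1]$ and $u_i=\alpha\varDelta_i(y_i)$. With $J_i=D_i-\mathbf 1_{m_i,1}N_i$ put $$\begin{bmatrix}\varPsi_{1,i}&\varPsi_{2,i}\\ \varPsi_{2,i}^*&\varPsi_{3,i}\end{bmatrix}=\begin{bmatrix}N_i^*&J_i^*\\0&-I\end{bmatrix}\varPi_i\begin{bmatrix}N_i&0\\J_i&-I\end{bmatrix}.$$ **Partition.** Let $\mathscr F_1,\dots,\mathscr F_c\subset\mathscr E$ be nonempty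 with union $\mathscr E$ and connected edge-induced subgraphs. For edges $k,\ell$ let $\mathcal L_k$ be the set of edges other than $k$ that share an endpoint with $k$, $\mathcal O_k=\{p: k\in\mathscr F_p\}$, $\mathcal Q_{k,\ell}=\{p:k,\ell\in\mathscr F_p\}$; for $i\in\mathcal V$ let $\mathcal J_i=\{p:\mathscr E_i\cap\mathscr F_p\ne\emptyset\}$, and let $\mathcal U_p=\{i:p\in\mathcal J_i\}$. Assume $\bigcup_{p\in\mathcal O_k}\mathscr F_p\setminus\{k\}\supset\mathcal L_k$ for every edge $k$. **Local operators.** For $p\in\{1,\dots,c\}$ let $\hat m_p=\sum_{i\in\mathcal U_p}m_i$, with coordinates indexed by the pairs $(i,j)$, $i\in\mathcal U_p$, $j\in\mathcal N_i$. For $k=\{a,b\}\in\mathscr F_p$, $a<b$, let $\hat B_{p,k}\in\mathbb R^{\hat m_p}$ have entry $1$ at $(a,b)$, $-1$ at $(b,a)$ and $0$ elsewhere, and let $\hat L_{p,k}=\hat B_{p,k}\hat B_{p,k}'$. With $\hat D_p=\bigoplus_{i\in\mathcal U_p}D_i$ and $\hat\varPsi_{q,p}=\bigoplus_{i\in\mathcal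 U_p}\varPsi_{q,i}$ $(q=2,3)$, put $$\hat K_p=\Big(\sum_{k\in\mathscr F_p}\hat L_{p,k}\Big)\hat D_p,\quad \hat W_p=\bigoplus_{i\in\mathcal U_p}\tfrac1{|\mathcal J_i|}I_{m_i},\quad \hat X_p=\bigoplus_{i\in\mathcal U_p}\tfrac1{|\mathcal J_i|}\varPsi_{1,i},\quad \hat Y_p=\hat\varPsi_{2,p}\sum_{k\in\mathscr F_p}\tfrac1{|\mathcal O_k|}\hat L_{p,k},$$ $$\hat Z_p=\sum_{k\in\mathscr F_p}\tfrac1{|\mathcal O_k|}\hat L_{p,k}\hat\varPsi_{3,p}\hat L_{p,k}+\sum_{k\in\mathscr F_p}\ \sum_{\ell\in\mathscr F_p\cap\mathcal L_k}\tfrac1{|\mathcal Q_{k,\ell}|}\hat L_{p,k}\hat\varPsi_{3,p}\hat L_{p,\ell}.$$ **Theorem.** Suppose that for every $p\in\{1,\dots,c\}$ there is $\epsilon_p>0$ such that for all $\hat z\in\mathbf L_2^{\hat m_p}$ $$\left\langle\begin{bmatrix}I\\ \hat K_p\end{bmatrix}\hat z,\begin{bmatrix}\hat X_p+\epsilon_p\hat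 W_p&\tfrac12\hat Y_p\\ \tfrac12\hat Y_p^*&\tfrac14\hat Z_p\end{bmatrix}\begin{bmatrix}I\\ \hat K_p\end{bmatrix}\hat z\right\rangle\le0.$$ Then the uncertain networked system $[\![P,\varLambda\circ T\circ H]\!]$ is stable (in particular well-posed). -/

import Mathlib

open scoped NNReal ENNReal InnerProductSpace
open MeasureTheory

noncomputable section

namespace LinkNet

/-! ### Time axis, signals -/

/-- Continuous time or discrete time, fixed once and for all. -/
inductive TimeDomain where
  | continuous
  | discrete

namespace TimeDomain

/-- The set of time instants: the nonnegative reals, or the natural numbers (with zero). -/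
def Instant : TimeDomain → Type
  | continuous => ℝ≥0
  | discrete => ℕ

instance instMeasurableSpaceInstant : ∀ 𝕋 : TimeDomain, MeasurableSpace 𝕋.Instant
  | continuous => inferInstanceAs (MeasurableSpace ℝ≥0)
  | discrete => inferInstanceAs (MeasurableSpace ℕ)

/-- Lebesgue measure on the nonnegative reals, or counting measure on the natural numbers. -/
def measure : ∀ 𝕋 : TimeDomain, Measure 𝕋.Instant
  | continuous => Measure.comap (fun t : ℝ≥0 => (t : ℝ)) volume
  | discrete => (Measure.count : Measure ℕ)

/-- The truncation window: the instants `t < τ` in continuous time, `t ≤ τ` in discrete time. -/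
def window : ∀ 𝕋 : TimeDomain, 𝕋.Instant → Set 𝕋.Instant
  | continuous => fun τ => (Set.Iio τ : Set ℝ≥0)
  | discrete => fun τ => (Set.Iic τ : Set ℕ)

theorem measurableSet_window : ∀ (𝕋 : TimeDomain) (τ : 𝕋.Instant), MeasurableSet (𝕋.window τ)
  | continuous => fun (τ : ℝ≥0) => measurableSet_Iio (a := τ)
  | discrete => fun (τ : ℕ) => measurableSet_Iic (a := τ)

end TimeDomain

variable (𝕋 : TimeDomain)

/-- The scalar extended space: (classes of) measurable real signals all of whose truncations
have finite energy. -/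
def L2e : Submodule ℝ (𝕋.Instant →ₘ[𝕋.measure] ℝ) where
  carrier := {v | ∀ τ, MemLp ((𝕋.window τ).indicator v) 2 𝕋.measure}
  zero_mem' τ := by
    refine MemLp.ae_eq ?_ (MemLp.zero (ε := ℝ))
    filter_upwards [AEEqFun.coeFn_zero (α := 𝕋.Instant) (β := ℝ) (μ := 𝕋.measure)] with t ht
    by_cases h : t ∈ 𝕋.window τ <;> simp [h, ht]
  add_mem' := by
    intro v w hv hw τ
    refine MemLp.ae_eq ?_ ((hv τ).add (hw τ))
    filter_upwards [AEEqFun.coeFn_add v w] with t ht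
    by_cases h : t ∈ 𝕋.window τ <;> simp [h, ht]
  smul_mem' := by
    intro a v hv τ
    refine MemLp.ae_eq ?_ ((hv τ).const_smul a)
    filter_upwards [AEEqFun.coeFn_smul a v] with t ht
    by_cases h : t ∈ 𝕋.window τ <;> simp [h, ht]

/-- Vector signals in the extended space, with coordinates indexed by `ι`. -/
abbrev Sig (ι : Type) : Type := ι → L2e 𝕋

/-- Finite energy vector signals: a Hilbert space with
`⟪v, u⟫ = ∑ i, ∫ v i * u i`. -/
abbrev L2 (ι : Type) : Type := PiLp 2 (fun _ : ι => Lp ℝ 2 𝕋.measure)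

variable {𝕋}

/-- Scalar truncation: the signal inside the window, and zero outside. -/
def scalarTrunc (τ : 𝕋.Instant) (v : L2e 𝕋) : L2e 𝕋 :=
  ⟨AEEqFun.mk ((𝕋.window τ).indicator (v : 𝕋.Instant →ₘ[𝕋.measure] ℝ))
      (v.2 τ).aestronglyMeasurable,
    fun σ => by
      refine MemLp.ae_eq ?_ ((v.2 τ).indicator (𝕋.measurableSet_window σ))
      filter_upwards [AEEqFun.coeFn_mk _ (v.2 τ).aestronglyMeasurable] with t ht
      by_cases h : t ∈ 𝕋.window σ <;> simp [h, ht]⟩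

/-- Truncation of a vector signal. -/
def trunc {ι : Type} (τ : 𝕋.Instant) (v : Sig 𝕋 ι) : Sig 𝕋 ι := fun i => scalarTrunc τ (v i)

/-- The inclusion of the finite energy scalar signals in the extended space. -/
def scalarIncl : Lp ℝ 2 𝕋.measure →ₗ[ℝ] L2e 𝕋 where
  toFun v := ⟨(v : 𝕋.Instant →ₘ[𝕋.measure] ℝ),
    fun τ => (Lp.memLp v).indicator (𝕋.measurableSet_window τ)⟩
  map_add' _ _ := rfl
  map_smul' _ _ := rfl

/-- The inclusion of the finite energy vector signals in the extended space. -/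
def incl {ι : Type} : L2 𝕋 ι →ₗ[ℝ] Sig 𝕋 ι where
  toFun v := fun i => scalarIncl (v i)
  map_add' v w := by funext i; simp
  map_smul' a v := by funext i; simp

theorem incl_injective {ι : Type} : Function.Injective (incl : L2 𝕋 ι →ₗ[ℝ] Sig 𝕋 ι) := by
  intro v w h
  ext1 i
  have hi := congrArg Subtype.val (congrFun h i)
  exact Subtype.ext hi

/-! ### Systems -/

section Systems

variable {ι κ : Type}

/-- Causality. -/
def IsCausal (G : Sig 𝕋 ι → Sig 𝕋 κ) : Prop :=
  ∀ (τ : 𝕋.Instant) (u : Sig 𝕋 ι), trunc τ (G u) = trunc τ (G (trunc τ u))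

/-- A system: a causal map with `G 0 = 0`. -/
def IsSystem (G : Sig 𝕋 ι → Sig 𝕋 κ) : Prop := IsCausal G ∧ G 0 = 0

variable [Fintype ι] [Fintype κ]

/-- Boundedness: finite energy inputs yield finite energy outputs, with finite gain. -/
def IsBounded (G : Sig 𝕋 ι → Sig 𝕋 κ) : Prop :=
  ∃ γ : ℝ, 0 < γ ∧ ∀ u : L2 𝕋 ι, ∃ y : L2 𝕋 κ, incl y = G (incl u) ∧ ‖y‖ ≤ γ * ‖u‖

/-- A stable system: a bounded system. -/
def IsStable (G : Sig 𝕋 ι → Sig 𝕋 κ) : Prop := IsSystem G ∧ IsBounded G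

/-- `S` is the closed-loop map of the feedback interconnection of `G` and `Δ`: for every
disturbance `(d_y, d_u)` the pair `S (d_y, d_u)` is the unique solution `(y, u)` of
`y = G u + d_y`, `u = Δ y + d_u`. Pairs of signals are signals indexed by a sum type. -/
def IsLoopMap (G : Sig 𝕋 ι → Sig 𝕋 κ) (Δ : Sig 𝕋 κ → Sig 𝕋 ι)
    (S : Sig 𝕋 (κ ⊕ ι) → Sig 𝕋 (κ ⊕ ι)) : Prop :=
  ∀ (dy : Sig 𝕋 κ) (du : Sig 𝕋 ι) (y : Sig 𝕋 κ) (u : Sig 𝕋 ι),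
    (y = G u + dy ∧ u = Δ y + du) ↔ Sum.elim y u = S (Sum.elim dy du)

/-- Well-posedness of the feedback interconnection of `G` and `Δ`. -/
def LoopWellPosed (G : Sig 𝕋 ι → Sig 𝕋 κ) (Δ : Sig 𝕋 κ → Sig 𝕋 ι) : Prop :=
  ∃ S, IsLoopMap G Δ S ∧ IsCausal S

/-- Stability of the feedback interconnection of `G` and `Δ`: it is well-posed, and the
closed-loop map is bounded. -/
def LoopStable (G : Sig 𝕋 ι → Sig 𝕋 κ) (Δ : Sig 𝕋 κ → Sig 𝕋 ι) : Prop :=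
  ∃ S, IsLoopMap G Δ S ∧ IsCausal S ∧ IsBounded S

variable (𝕋 ι κ) in
/-- Stable linear systems. -/
structure StableLinear where
  /-- the action on the extended space -/
  map : Sig 𝕋 ι →ₗ[ℝ] Sig 𝕋 κ
  stable : IsStable map

theorem StableLinear.exists_image (G : StableLinear 𝕋 ι κ) (u : L2 𝕋 ι) :
    ∃ y : L2 𝕋 κ, incl y = G.map (incl u) := by
  obtain ⟨_, γ, _, h⟩ := G.stable
  exact (h u).imp fun _ hy => hy.1

/-- The restriction of a stable linear system to finite energy signals, a bounded operator. -/
def StableLinear.toL2 (G : StableLinear 𝕋 ι κ) : L2 𝕋 ι →L[ℝ] L2 𝕋 κ :=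
  LinearMap.mkContinuousOfExistsBound
    { toFun := fun u => (G.exists_image u).choose
      map_add' := fun u v => incl_injective <| by
        refine (G.exists_image (u + v)).choose_spec.trans ?_
        refine Eq.trans ?_ (map_add incl _ _).symm
        refine Eq.trans ?_ (congrArg₂ (· + ·) (G.exists_image u).choose_spec
          (G.exists_image v).choose_spec).symm
        exact (congrArg G.map (map_add incl u v)).trans (map_add G.map _ _)
      map_smul' := fun a u => incl_injective <| by
        refine (G.exists_image (a • u)).choose_spec.trans ?_
        refine Eq.trans ?_ (map_smul incl _ _).symm
        refine Eq.trans ?_ (congrArg (a • ·) (G.exists_image u).choose_spec).symm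
        exact (congrArg G.map (map_smul incl a u)).trans (map_smul G.map _ _) }
    (by
      obtain ⟨_, γ, _, h⟩ := G.stable
      refine ⟨γ, fun u => ?_⟩
      obtain ⟨y, hy, hle⟩ := h u
      have he : (G.exists_image u).choose = y :=
        incl_injective ((G.exists_image u).choose_spec.trans hy.symm)
      exact (congrArg norm he).trans_le hle)

theorem StableLinear.incl_toL2 (G : StableLinear 𝕋 ι κ) (u : L2 𝕋 ι) :
    incl (G.toL2 u) = G.map (incl u) :=
  (G.exists_image u).choose_spec

end Systems

/-! ### Matrices as pointwise multiplication operators, direct sums, inverses -/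

section Operators

variable {ι κ : Type}

/-- Pointwise multiplication by a matrix, on the extended space. -/
def matSig [Fintype ι] (A : Matrix κ ι ℝ) : Sig 𝕋 ι →ₗ[ℝ] Sig 𝕋 κ where
  toFun v := fun r => ∑ s, A r s • v s
  map_add' v w := by funext r; simp [Finset.sum_add_distrib]
  map_smul' a v := by
    funext r
    simp only [Pi.smul_apply, RingHom.id_apply, Finset.smul_sum]
    exact Finset.sum_congr rfl fun s _ => smul_comm _ _ _

/-- Pointwise multiplication by a matrix, on finite energy signals. -/
def matL2 [Fintype ι] [Fintype κ] (A : Matrix κ ι ℝ) : L2 𝕋 ι →L[ℝ] L2 𝕋 κ :=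
  ((PiLp.continuousLinearEquiv 2 ℝ (fun _ : κ => Lp ℝ 2 𝕋.measure)).symm :
      (κ → Lp ℝ 2 𝕋.measure) →L[ℝ] L2 𝕋 κ) ∘L
    ContinuousLinearMap.pi fun r => ∑ s, A r s • PiLp.proj 2 (fun _ : ι => Lp ℝ 2 𝕋.measure) s

/-- The inverse of a bijective linear map on the extended space (and zero otherwise). -/
def sigInv (A : Module.End ℝ (Sig 𝕋 ι)) : Module.End ℝ (Sig 𝕋 ι) := Ring.inverse A

variable {I : Type} {α β : I → Type}

/-- The direct sum of a family of maps: the coordinates of the signals are indexed by pairs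
of a block `i` and a coordinate in the block. -/
def directSum (A : ∀ i, Sig 𝕋 (α i) → Sig 𝕋 (β i)) : Sig 𝕋 (Σ i, α i) → Sig 𝕋 (Σ i, β i) :=
  fun v x => A x.1 (fun a => v ⟨x.1, a⟩) x.2

/-- The direct sum of a family of linear maps. -/
def directSumLin (A : ∀ i, Sig 𝕋 (α i) →ₗ[ℝ] Sig 𝕋 (β i)) :
    Sig 𝕋 (Σ i, α i) →ₗ[ℝ] Sig 𝕋 (Σ i, β i) where
  toFun := directSum fun i => A i
  map_add' v w := by
    funext x
    exact congrFun (map_add (A x.1) (fun a => v ⟨x.1, a⟩) (fun a => w ⟨x.1, a⟩)) x.2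
  map_smul' c v := by
    funext x
    exact congrFun (map_smul (A x.1) c (fun a => v ⟨x.1, a⟩)) x.2

/-- The direct sum of scalar systems. -/
def diagSys (f : ι → Sig 𝕋 Unit → Sig 𝕋 Unit) : Sig 𝕋 ι → Sig 𝕋 ι :=
  fun v k => f k (fun _ => v k) ()

variable [Fintype I] [∀ i, Fintype (α i)] [∀ i, Fintype (β i)]

/-- The `i`-th block of a finite energy signal. -/
def blockL2 (i : I) : L2 𝕋 (Σ i, α i) →L[ℝ] L2 𝕋 (α i) :=
  ((PiLp.continuousLinearEquiv 2 ℝ (fun _ : α i => Lp ℝ 2 𝕋.measure)).symm :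
      (α i → Lp ℝ 2 𝕋.measure) →L[ℝ] L2 𝕋 (α i)) ∘L
    ContinuousLinearMap.pi fun a =>
      PiLp.proj 2 (fun _ : (Σ i, α i) => Lp ℝ 2 𝕋.measure) ⟨i, a⟩

/-- The direct sum of a family of bounded operators on finite energy signals. -/
def directSumL2 (A : ∀ i, L2 𝕋 (α i) →L[ℝ] L2 𝕋 (β i)) :
    L2 𝕋 (Σ i, α i) →L[ℝ] L2 𝕋 (Σ i, β i) :=
  ((PiLp.continuousLinearEquiv 2 ℝ (fun _ : (Σ i, β i) => Lp ℝ 2 𝕋.measure)).symm :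
      ((Σ i, β i) → Lp ℝ 2 𝕋.measure) →L[ℝ] L2 𝕋 (Σ i, β i)) ∘L
    ContinuousLinearMap.pi fun x =>
      PiLp.proj 2 (fun _ : β x.1 => Lp ℝ 2 𝕋.measure) x.2 ∘L A x.1 ∘L blockL2 x.1

end Operators

/-! ### Quadratic forms of self-adjoint block operators -/

section Blocks

variable {E F : Type} [NormedAddCommGroup E] [InnerProductSpace ℝ E] [CompleteSpace E]
  [NormedAddCommGroup F] [InnerProductSpace ℝ F] [CompleteSpace F]

/-- The inner product of the pair `(y, u)` with its image under the block operator with rows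
`(A, B)` and `(B†, C)`. -/
def blockForm (A : E →L[ℝ] E) (B : F →L[ℝ] E) (C : F →L[ℝ] F) (y : E) (u : F) : ℝ :=
  ⟪y, A y + B u⟫_ℝ + ⟪u, B.adjoint y + C u⟫_ℝ

/-- Upper left block of the transformed multiplier
`(N†, J†; 0, -I) (Pi₁, Pi₂; Pi₂†, Pi₃) (N, 0; J, -I)`. -/
def psiOne (N : F →L[ℝ] E) (J : F →L[ℝ] F)
    (Pi₁ : E →L[ℝ] E) (Pi₂ : F →L[ℝ] E) (Pi₃ : F →L[ℝ] F) : F →L[ℝ] F :=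
  N.adjoint ∘L (Pi₁ ∘L N + Pi₂ ∘L J) + J.adjoint ∘L (Pi₂.adjoint ∘L N + Pi₃ ∘L J)

/-- Upper right block of the transformed multiplier
`(N†, J†; 0, -I) (Pi₁, Pi₂; Pi₂†, Pi₃) (N, 0; J, -I)`. Its lower right block is `Pi₃`. -/
def psiTwo (N : F →L[ℝ] E) (J : F →L[ℝ] F)
    (Pi₂ : F →L[ℝ] E) (Pi₃ : F →L[ℝ] F) : F →L[ℝ] F :=
  -(N.adjoint ∘L Pi₂ + J.adjoint ∘L Pi₃)

end Blocks

/-! ### The networked system -/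

section Network

variable {V : Type} [Fintype V] (Γ : SimpleGraph V) [DecidableRel Γ.Adj]

/-- The neighbours of agent `i`; they index the inputs of agent `i`, and the links that leave
agent `i`. -/
abbrev Nbr (i : V) : Type := Γ.neighborSet i

/-- The pairs of an agent and one of its neighbours; there are twice as many as edges. -/
abbrev Port : Type := Σ i : V, Nbr Γ i

/-- The column with all entries equal to one, indexed by the neighbours of `i`. -/
def onesCol (i : V) : Matrix (Nbr Γ i) Unit ℝ := fun _ _ => 1

/-- The fan-out of the agent outputs to the links. -/
def fanOut : Sig 𝕋 (Σ _ : V, Unit) →ₗ[ℝ] Sig 𝕋 (Port Γ) :=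
  directSumLin fun i => matSig (onesCol Γ i)

/-- The routing permutation matrix: the input of agent `i` from its neighbour `j` is the
output of the link from `j` to `i`. -/
def routing [LinearOrder V] : Matrix (Port Γ) (Port Γ) ℝ :=
  fun r q => if q.1 = (r.2 : V) ∧ (q.2 : V) = r.1 then 1 else 0

variable {Γ}

/-- The direct sum of the agents. -/
def agents (H : ∀ i, Sig 𝕋 (Nbr Γ i) →ₗ[ℝ] Sig 𝕋 Unit) :
    Sig 𝕋 (Port Γ) →ₗ[ℝ] Sig 𝕋 (Σ _ : V, Unit) :=
  directSumLin H

/-- The direct sum of the links. -/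
def links (Λ : ∀ i, Nbr Γ i → Sig 𝕋 Unit → Sig 𝕋 Unit) : Sig 𝕋 (Port Γ) → Sig 𝕋 (Port Γ) :=
  directSum fun i => diagSys (Λ i)

/-- The deviation from ideal links at agent `i`: the map `(⊕ₖ Λ i k - I) ∘ 1`. -/
def agentDelta (Λ : ∀ i, Nbr Γ i → Sig 𝕋 Unit → Sig 𝕋 Unit) (i : V) :
    Sig 𝕋 Unit → Sig 𝕋 (Nbr Γ i) :=
  fun y => diagSys (Λ i) (matSig (onesCol Γ i) y) - matSig (onesCol Γ i) y

/-- The deviation from ideal links: the map `(Λ - I) ∘ T`. -/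
def delta (Λ : ∀ i, Nbr Γ i → Sig 𝕋 Unit → Sig 𝕋 Unit) :
    Sig 𝕋 (Σ _ : V, Unit) → Sig 𝕋 (Port Γ) :=
  fun y => links Λ (fanOut Γ y) - fanOut Γ y

/-- The network with ideal links as seen by the deviation: the map `H (P - T H)⁻¹`. -/
def nominal [LinearOrder V] (H : ∀ i, Sig 𝕋 (Nbr Γ i) →ₗ[ℝ] Sig 𝕋 Unit) :
    Sig 𝕋 (Port Γ) →ₗ[ℝ] Sig 𝕋 (Σ _ : V, Unit) :=
  agents H ∘ₗ sigInv (matSig (routing Γ) - fanOut Γ ∘ₗ agents H)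

/-! ### Edge partitions -/

variable [LinearOrder V] {c : ℕ}

/-- Localized edge partitions: nonempty, covering sets of edges with connected edge-induced
subgraphs. -/
structure IsLocalizedEdgePartition (Γ : SimpleGraph V) [DecidableRel Γ.Adj]
    (F : Fin c → Finset (Sym2 V)) : Prop where
  subset : ∀ p, F p ⊆ Γ.edgeFinset
  nonempty : ∀ p, (F p).Nonempty
  connected : ∀ p, ((SimpleGraph.fromEdgeSet (F p : Set (Sym2 V))).induce
    {i | (Γ.incidenceFinset i ∩ F p).Nonempty}).Connected
  cover : ∀ e ∈ Γ.edgeFinset, ∃ p, e ∈ F p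

variable (Γ) in
/-- The other edges at the two endpoints of the edge `k`. -/
def adjEdges (k : Sym2 V) : Finset (Sym2 V) := (k.toFinset.biUnion fun i => Γ.incidenceFinset i) \ {k}

variable (Γ) in
/-- The agents of the `p`-th element of the partition. -/
def partVerts (F : Fin c → Finset (Sym2 V)) (p : Fin c) : Finset V :=
  Finset.univ.filter fun i => (Γ.incidenceFinset i ∩ F p).Nonempty

variable (Γ) in
/-- The partition indexes of the agent `i`. -/
def vertParts (F : Fin c → Finset (Sym2 V)) (i : V) : Finset (Fin c) :=
  Finset.univ.filter fun p => (Γ.incidenceFinset i ∩ F p).Nonempty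

/-- The partition indexes of the edge `k`. -/
def edgeParts (F : Fin c → Finset (Sym2 V)) (k : Sym2 V) : Finset (Fin c) :=
  Finset.univ.filter fun p => k ∈ F p

/-- The indexes of the partition elements that contain both edges `k` and `l`. -/
def edgePairParts (F : Fin c → Finset (Sym2 V)) (k l : Sym2 V) : Finset (Fin c) :=
  Finset.univ.filter fun p => k ∈ F p ∧ l ∈ F p

variable (Γ) in
/-- For every edge `k`, the other edges at its endpoints are all covered by the partition
elements that contain `k`. -/
def CoversAdjacentEdges (F : Fin c → Finset (Sym2 V)) : Prop :=
  ∀ k ∈ Γ.edgeFinset, adjEdges Γ k ⊆ ((edgeParts F k).biUnion F) \ {k}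

variable (Γ) in
/-- The incidence matrix of the subsystem graph: the edge `{i, j}` with `i < j` has the entry
`1` at the port `(i, j)` and the entry `-1` at the port `(j, i)`. -/
def incidence : Matrix (Port Γ) (Sym2 V) ℝ :=
  fun r k => if s(r.1, (r.2 : V)) = k then (if r.1 < (r.2 : V) then 1 else -1) else 0

end Network

/-! ### Localized operators -/

section Localized

variable {V : Type} [Fintype V] [LinearOrder V] (Γ : SimpleGraph V) [DecidableRel Γ.Adj]
  {c : ℕ} (F : Fin c → Finset (Sym2 V)) (p : Fin c)

/-- The ports of the agents in the `p`-th element of the partition. -/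
abbrev LocalPort : Type := Σ i : partVerts Γ F p, Nbr Γ (i : V)

/-- The local part of the incidence column of the edge `k`. -/
def localIncidence (k : Sym2 V) : LocalPort Γ F p → ℝ :=
  fun r => incidence Γ ⟨(r.1 : V), r.2⟩ k

/-- The local Laplacian of the edge `k`. -/
def localLap (k : Sym2 V) : Matrix (LocalPort Γ F p) (LocalPort Γ F p) ℝ :=
  Matrix.vecMulVec (localIncidence Γ F p k) (localIncidence Γ F p k)

variable {Γ}

/-- The direct sum over the agents in the `p`-th element of the partition. -/
def localSum (A : ∀ i, L2 𝕋 (Nbr Γ i) →L[ℝ] L2 𝕋 (Nbr Γ i)) :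
    L2 𝕋 (LocalPort Γ F p) →L[ℝ] L2 𝕋 (LocalPort Γ F p) :=
  directSumL2 fun i : partVerts Γ F p => A i

/-- `K̂ = (∑ₖ L̂ₖ) D̂`. -/
def localK (D : ∀ i, L2 𝕋 (Nbr Γ i) →L[ℝ] L2 𝕋 (Nbr Γ i)) :
    L2 𝕋 (LocalPort Γ F p) →L[ℝ] L2 𝕋 (LocalPort Γ F p) :=
  matL2 (∑ k ∈ F p, localLap Γ F p k) ∘L localSum F p D

variable (Γ) in
/-- `Ŵ = ⊕ᵢ ωᵢ I`. -/
def localW : L2 𝕋 (LocalPort Γ F p) →L[ℝ] L2 𝕋 (LocalPort Γ F p) :=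
  localSum F p fun i => (1 / ((vertParts Γ F i).card : ℝ)) • ContinuousLinearMap.id ℝ _

/-- `X̂ = ⊕ᵢ ξᵢ Ψ₁ᵢ`. -/
def localX (Ψ₁ : ∀ i, L2 𝕋 (Nbr Γ i) →L[ℝ] L2 𝕋 (Nbr Γ i)) :
    L2 𝕋 (LocalPort Γ F p) →L[ℝ] L2 𝕋 (LocalPort Γ F p) :=
  localSum F p fun i => (1 / ((vertParts Γ F i).card : ℝ)) • Ψ₁ i

/-- `Ŷ = Ψ̂₂ (∑ₖ ηₖ L̂ₖ)`. -/
def localY (Ψ₂ : ∀ i, L2 𝕋 (Nbr Γ i) →L[ℝ] L2 𝕋 (Nbr Γ i)) :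
    L2 𝕋 (LocalPort Γ F p) →L[ℝ] L2 𝕋 (LocalPort Γ F p) :=
  localSum F p Ψ₂ ∘L
    matL2 (∑ k ∈ F p, (1 / ((edgeParts F k).card : ℝ)) • localLap Γ F p k)

/-- `Ẑ = ∑ₖ ζₖ L̂ₖ Ψ̂₃ L̂ₖ + ∑ₖ ∑ₗ θₖₗ L̂ₖ Ψ̂₃ L̂ₗ`. -/
def localZ (Ψ₃ : ∀ i, L2 𝕋 (Nbr Γ i) →L[ℝ] L2 𝕋 (Nbr Γ i)) :
    L2 𝕋 (LocalPort Γ F p) →L[ℝ] L2 𝕋 (LocalPort Γ F p) :=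
  (∑ k ∈ F p, (1 / ((edgeParts F k).card : ℝ)) •
    (matL2 (localLap Γ F p k) ∘L localSum F p Ψ₃ ∘L matL2 (localLap Γ F p k))) +
  ∑ k ∈ F p, ∑ l ∈ F p ∩ adjEdges Γ k, (1 / ((edgePairParts F k l).card : ℝ)) •
    (matL2 (localLap Γ F p k) ∘L localSum F p Ψ₃ ∘L matL2 (localLap Γ F p l))

/-- `Jᵢ = Dᵢ - 1 Nᵢ`. -/
def agentJ (N : ∀ i, L2 𝕋 (Nbr Γ i) →L[ℝ] L2 𝕋 Unit)
    (D : ∀ i, L2 𝕋 (Nbr Γ i) →L[ℝ] L2 𝕋 (Nbr Γ i)) (i : V) :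
    L2 𝕋 (Nbr Γ i) →L[ℝ] L2 𝕋 (Nbr Γ i) :=
  D i - matL2 (onesCol Γ i) ∘L N i

/-- The local integral quadratic constraint of the `p`-th element of the partition. -/
def LocalIQC (N : ∀ i, L2 𝕋 (Nbr Γ i) →L[ℝ] L2 𝕋 Unit)
    (D : ∀ i, L2 𝕋 (Nbr Γ i) →L[ℝ] L2 𝕋 (Nbr Γ i))
    (Pi₁ : V → (L2 𝕋 Unit →L[ℝ] L2 𝕋 Unit))
    (Pi₂ : ∀ i, L2 𝕋 (Nbr Γ i) →L[ℝ] L2 𝕋 Unit)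
    (Pi₃ : ∀ i, L2 𝕋 (Nbr Γ i) →L[ℝ] L2 𝕋 (Nbr Γ i)) : Prop :=
  ∃ ε : ℝ, 0 < ε ∧ ∀ z : L2 𝕋 (LocalPort Γ F p),
    blockForm
      (localX F p (fun i => psiOne (N i) (agentJ N D i) (Pi₁ i) (Pi₂ i) (Pi₃ i)) +
        ε • localW Γ F p)
      ((1 / 2 : ℝ) • localY F p (fun i => psiTwo (N i) (agentJ N D i) (Pi₂ i) (Pi₃ i)))
      ((1 / 4 : ℝ) • localZ F p Pi₃)
      z (localK F p D z) ≤ 0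

end Localized

end LinkNet

end

/-! Write `P` for the routing, `T` for the fan-out, `G = H (P - T H)⁻¹` and `Δ = (Λ - I) ∘ T`. Since
`P` is an involution, putting `e = (P - T H) y` turns the network equations into the single equation
`e = Δ (G e) + d` with `d = d_u + P d_y`. Stability of the ideal network makes `(P - T H)⁻¹` and `G`
stable, so it suffices to bound `e` by `d` (`bijective_and_isBounded_sigInv`,
`loopStable_of_closedLoop`).

For finite energy `e`, the Bezout identity gives a finite energy `z` with `G e = N z` and `e = J z -
(I - P) D z` (`exists_coprime_image`). Moreover `I - P` is the sum of the rank-one edge Laplacians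
`Lₖ` (`sum_edgeLap`). Thus the multiplier form at `(G e, e)` expands into terms indexed by agents,
edges and pairs of edges. Pairs without a common endpoint contribute nothing, because the
multipliers are block diagonal, and the covering hypothesis puts every other pair into some
partition element. The weights correct for multiple occurrences, so the local forms add up to the
network form (`sum_blockForm_local_eq`), which is therefore at most `-ε ‖z‖²`.

The constraint on the links makes the same form nonnegative at `(G e, e - d)` whenever `e - d = α Δ
(G e)`. Comparing the two yields `‖e‖ ≤ C ‖d‖` with `C` independent of `α ∈ [0, 1]`
(`exists_aprioriBound`). This concerns only solutions already known to have finite energy. A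
homotopy from `α = 0` to `α = 1` in small steps shows that all solutions with finite energy `d` are
of this kind (`exists_incl_of_aprioriBound`). -/

open scoped NNReal ENNReal InnerProductSpace
open MeasureTheory

noncomputable section

namespace LinkNet

/-! ### Truncation, causality, and the homotopy argument. -/

section Signals

variable {𝕋 : TimeDomain} {ι κ : Type}

/-- Scalar truncation as a linear map into the finite energy signals. -/
def truncLp (τ : 𝕋.Instant) : L2e 𝕋 →ₗ[ℝ] Lp ℝ 2 𝕋.measure where
  toFun v := (v.2 τ).toLp
  map_add' v w := by
    rw [← MemLp.toLp_add]
    refine MemLp.toLp_congr _ _ ?_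
    filter_upwards [AEEqFun.coeFn_add (v : 𝕋.Instant →ₘ[𝕋.measure] ℝ) w] with t ht
    by_cases h : t ∈ 𝕋.window τ <;> simp [h, ht]
  map_smul' a v := by
    rw [RingHom.id_apply, ← MemLp.toLp_const_smul]
    refine MemLp.toLp_congr _ _ ?_
    filter_upwards [AEEqFun.coeFn_smul a (v : 𝕋.Instant →ₘ[𝕋.measure] ℝ)] with t ht
    by_cases h : t ∈ 𝕋.window τ <;> simp [h, ht]

theorem norm_truncLp_scalarIncl_le (τ : 𝕋.Instant) (f : Lp ℝ 2 𝕋.measure) :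
    ‖truncLp τ (scalarIncl f)‖ ≤ ‖f‖ := by
  refine Lp.norm_le_norm_of_ae_le ?_
  filter_upwards [MemLp.coeFn_toLp ((scalarIncl f).2 τ)] with t ht
  refine (congrArg norm ht).trans_le ?_
  exact norm_indicator_le_norm_self _ _

theorem truncLp_scalarTrunc (τ : 𝕋.Instant) (v : L2e 𝕋) :
    truncLp τ (scalarTrunc τ v) = truncLp τ v := by
  refine MemLp.toLp_congr ((scalarTrunc τ v).2 τ) (v.2 τ) ?_
  filter_upwards [AEEqFun.coeFn_mk _ (v.2 τ).aestronglyMeasurable] with t ht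
  by_cases h : t ∈ 𝕋.window τ
  · simp only [h, Set.indicator_of_mem]
    refine Eq.trans ht ?_
    simp [h]
  · simp [h]

/-- Truncation as a linear map into the finite energy signals. -/
def truncL2 (τ : 𝕋.Instant) : Sig 𝕋 ι →ₗ[ℝ] L2 𝕋 ι where
  toFun v := WithLp.toLp 2 fun i => truncLp τ (v i)
  map_add' v w := by ext1 i; simp
  map_smul' a v := by ext1 i; simp

theorem incl_truncL2 (τ : 𝕋.Instant) (v : Sig 𝕋 ι) : incl (truncL2 τ v) = trunc τ v := rfl

theorem truncL2_trunc (τ : 𝕋.Instant) (v : Sig 𝕋 ι) : truncL2 τ (trunc τ v) = truncL2 τ v := by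
  ext1 i
  exact truncLp_scalarTrunc τ (v i)

theorem trunc_eq_iff (τ : 𝕋.Instant) (v w : Sig 𝕋 ι) :
    trunc τ v = trunc τ w ↔ truncL2 τ v = truncL2 τ w :=
  incl_injective.eq_iff (a := truncL2 τ v) (b := truncL2 τ w)

/-- Causality, as dependence of truncated outputs on truncated inputs only. -/
theorem isCausal_iff {G : Sig 𝕋 ι → Sig 𝕋 κ} :
    IsCausal G ↔ ∀ τ u v, truncL2 τ u = truncL2 τ v → truncL2 τ (G u) = truncL2 τ (G v) := by
  constructor
  · intro h τ u v huv
    rw [← trunc_eq_iff] at huv ⊢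
    rw [h τ u, h τ v, huv]
  · intro h τ u
    rw [trunc_eq_iff]
    exact h τ _ _ (truncL2_trunc τ u).symm

theorem IsCausal.comp {μ : Type} {G : Sig 𝕋 ι → Sig 𝕋 κ} {F : Sig 𝕋 κ → Sig 𝕋 μ}
    (hF : IsCausal F) (hG : IsCausal G) : IsCausal (F ∘ G) := by
  rw [isCausal_iff] at *
  exact fun τ u v h => hF τ _ _ (hG τ _ _ h)

theorem truncL2_eq_iff (τ : 𝕋.Instant) (v w : Sig 𝕋 ι) :
    truncL2 τ v = truncL2 τ w ↔ ∀ i, truncLp τ (v i) = truncLp τ (w i) := by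
  constructor
  · intro h i
    exact congrArg (fun x : L2 𝕋 ι => x i) h
  · intro h
    ext1 i
    exact h i

theorem isCausal_matSig [Fintype ι] (A : Matrix κ ι ℝ) :
    IsCausal (matSig A : Sig 𝕋 ι → Sig 𝕋 κ) := by
  rw [isCausal_iff]
  intro τ u v h
  rw [truncL2_eq_iff] at h ⊢
  intro r
  simp [matSig, h]

/-- The closed-loop map from the second disturbance to the second signal. -/
theorem LoopWellPosed.exists_closedLoop {G : Sig 𝕋 ι → Sig 𝕋 κ} {Δ : Sig 𝕋 κ → Sig 𝕋 ι}
    (h : LoopWellPosed G Δ) :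
    ∃ E : Sig 𝕋 ι → Sig 𝕋 ι, IsCausal E ∧ ∀ d e, e = Δ (G e) + d ↔ e = E d := by
  obtain ⟨S, hS, hc⟩ := h
  -- With zero first disturbance the first signal is `G e`, so it can be eliminated.
  refine ⟨fun d i => S (Sum.elim 0 d) (Sum.inr i), ?_, fun d e => ?_⟩
  · rw [isCausal_iff] at hc ⊢
    intro τ u v huv
    have h := hc τ (Sum.elim 0 u) (Sum.elim 0 v) (by
      rw [truncL2_eq_iff] at huv ⊢
      rintro (i | i)
      · rfl
      · exact huv i)
    rw [truncL2_eq_iff] at h ⊢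
    exact fun i => h (Sum.inr i)
  · constructor
    · intro h
      have := (hS 0 d (G e) e).1 ⟨by simp, h⟩
      exact funext fun i => congrFun this (Sum.inr i)
    · intro h
      have h' : S (Sum.elim 0 d) =
          Sum.elim (fun i => S (Sum.elim 0 d) (Sum.inl i)) e := by
        rw [h]; funext x; cases x <;> rfl
      obtain ⟨h1, h2⟩ := (hS 0 d _ e).2 h'.symm
      rw [add_zero] at h1
      rwa [h1] at h2

/-! ### Finite energy signals as signals with bounded truncations -/

/-- A sequence of instants whose windows exhaust the time axis. -/
def TimeDomain.instantSeq : ∀ 𝕋 : TimeDomain, ℕ → 𝕋.Instant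
  | .continuous => fun k => (k : ℝ≥0)
  | .discrete => fun k => (k : ℕ)

theorem TimeDomain.eventually_mem_window : ∀ (𝕋 : TimeDomain) (t : 𝕋.Instant),
    ∀ᶠ k in Filter.atTop, t ∈ 𝕋.window (𝕋.instantSeq k)
  | .continuous => fun (t : ℝ≥0) => by
    obtain ⟨N, hN⟩ := exists_nat_gt t
    filter_upwards [Filter.eventually_ge_atTop N] with k hk
    have h : t < (k : ℝ≥0) := hN.trans_le (by exact_mod_cast hk)
    exact h
  | .discrete => fun (t : ℕ) => by
    filter_upwards [Filter.eventually_ge_atTop t] with k hk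
    exact hk

/-- Fatou's lemma: truncations along an exhausting sequence of windows converge pointwise to `v`, so
the norm of `v` is at most the lower limit of theirs. -/
theorem exists_scalarIncl_of_norm_truncLp_le {v : L2e 𝕋} {C : ℝ}
    (h : ∀ τ, ‖truncLp τ v‖ ≤ C) : ∃ f : Lp ℝ 2 𝕋.measure, scalarIncl f = v := by
  have hm : AEStronglyMeasurable (v : 𝕋.Instant →ₘ[𝕋.measure] ℝ) 𝕋.measure :=
    AEEqFun.aestronglyMeasurable _
  have hlim : eLpNorm (v : 𝕋.Instant →ₘ[𝕋.measure] ℝ) 2 𝕋.measure ≤ ENNReal.ofReal C := by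
    refine (Lp.eLpNorm_lim_le_liminf_eLpNorm
      (f := fun k => (𝕋.window (𝕋.instantSeq k)).indicator
        (v : 𝕋.Instant →ₘ[𝕋.measure] ℝ))
      (fun k => (v.2 _).aestronglyMeasurable) _ ?_).trans ?_
    · refine Filter.Eventually.of_forall fun t => ?_
      refine tendsto_const_nhds.congr' ?_
      filter_upwards [𝕋.eventually_mem_window t] with k hk
      simp [hk]
    · refine Filter.liminf_le_of_frequently_le' (Filter.Frequently.of_forall fun k => ?_)
      have hk := h (𝕋.instantSeq k)
      have hk' : ‖(v.2 (𝕋.instantSeq k)).toLp‖ ≤ C := hk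
      rw [Lp.norm_toLp] at hk'
      exact (ENNReal.le_ofReal_iff_toReal_le (v.2 _).2.ne
        ((norm_nonneg _).trans hk)).2 hk'
  have hv : MemLp (v : 𝕋.Instant →ₘ[𝕋.measure] ℝ) 2 𝕋.measure :=
    ⟨hm, hlim.trans_lt ENNReal.ofReal_lt_top⟩
  refine ⟨hv.toLp, Subtype.ext ?_⟩
  exact AEEqFun.mk_coeFn (v : 𝕋.Instant →ₘ[𝕋.measure] ℝ)

variable [Fintype ι] [Fintype κ]

theorem norm_coord_le (u : L2 𝕋 ι) (i : ι) : ‖u i‖ ≤ ‖u‖ := PiLp.norm_apply_le u i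

theorem norm_le_sum_coord (u : L2 𝕋 ι) : ‖u‖ ≤ ∑ i, ‖u i‖ := by
  rw [PiLp.norm_eq_of_L2]
  refine Real.sqrt_le_iff.2 ⟨Finset.sum_nonneg fun i _ => norm_nonneg _, ?_⟩
  exact Finset.sum_sq_le_sq_sum_of_nonneg fun i _ => norm_nonneg _

theorem norm_truncL2_incl_le (τ : 𝕋.Instant) (u : L2 𝕋 ι) : ‖truncL2 τ (incl u)‖ ≤ ‖u‖ := by
  rw [PiLp.norm_eq_of_L2, PiLp.norm_eq_of_L2]
  gcongr with i
  exact norm_truncLp_scalarIncl_le τ (u i)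

theorem exists_incl_of_norm_truncL2_le {v : Sig 𝕋 ι} {C : ℝ}
    (h : ∀ τ, ‖truncL2 τ v‖ ≤ C) : ∃ u : L2 𝕋 ι, incl u = v := by
  have hi (i : ι) : ∃ f : Lp ℝ 2 𝕋.measure, scalarIncl f = v i :=
    exists_scalarIncl_of_norm_truncLp_le fun τ => (norm_coord_le (truncL2 τ v) i).trans (h τ)
  choose f hf using hi
  exact ⟨WithLp.toLp 2 f, funext hf⟩

/-- A gain bound of a causal system extends to truncated signals. -/
theorem IsCausal.norm_truncL2_le {G : Sig 𝕋 ι → Sig 𝕋 κ} (hG : IsCausal G) {γ : ℝ}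
    (hγ : ∀ u : L2 𝕋 ι, ∃ y : L2 𝕋 κ, incl y = G (incl u) ∧ ‖y‖ ≤ γ * ‖u‖)
    (τ : 𝕋.Instant) (u : Sig 𝕋 ι) : ‖truncL2 τ (G u)‖ ≤ γ * ‖truncL2 τ u‖ := by
  obtain ⟨y, hy, hle⟩ := hγ (truncL2 τ u)
  have h1 : truncL2 τ (G u) = truncL2 τ (incl y) := by
    rw [hy]
    exact isCausal_iff.1 hG τ _ _ (by rw [incl_truncL2, truncL2_trunc])
  rw [h1]
  exact (norm_truncL2_incl_le τ y).trans hle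

theorem isBounded_of_coord {G : Sig 𝕋 ι → Sig 𝕋 κ} (h : ∀ r, ∃ γ : ℝ, ∀ u : L2 𝕋 ι,
    ∃ y : Lp ℝ 2 𝕋.measure, scalarIncl y = G (incl u) r ∧ ‖y‖ ≤ γ * ‖u‖) : IsBounded G := by
  choose γ hγ using h
  -- The coordinate gains carry no sign; absolute values and `+ 1` make the total gain positive.
  refine ⟨∑ r, |γ r| + 1, by positivity, fun u => ?_⟩
  choose y hy hle using fun r => hγ r u
  refine ⟨WithLp.toLp 2 y, funext hy, (norm_le_sum_coord _).trans ?_⟩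
  rw [add_mul, Finset.sum_mul]
  refine le_add_of_le_of_nonneg (Finset.sum_le_sum fun r _ => (hle r).trans ?_) (by positivity)
  gcongr
  exact le_abs_self _

theorem IsBounded.comp {μ : Type} [Fintype μ] {G : Sig 𝕋 ι → Sig 𝕋 κ} {F : Sig 𝕋 κ → Sig 𝕋 μ}
    (hF : IsBounded F) (hG : IsBounded G) : IsBounded (F ∘ G) := by
  obtain ⟨a, ha, hF⟩ := hF
  obtain ⟨b, hb, hG⟩ := hG
  refine ⟨a * b, by positivity, fun u => ?_⟩
  obtain ⟨y, hy, hle⟩ := hG u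
  obtain ⟨w, hw, hle'⟩ := hF y
  refine ⟨w, by rw [hw, hy]; rfl, hle'.trans ?_⟩
  rw [mul_assoc]
  gcongr

theorem incl_matL2 (A : Matrix κ ι ℝ) (u : L2 𝕋 ι) : incl (matL2 A u) = matSig A (incl u) := by
  funext r
  simp [matL2, matSig, incl]

theorem isBounded_matSig (A : Matrix κ ι ℝ) : IsBounded (matSig A : Sig 𝕋 ι → Sig 𝕋 κ) := by
  refine ⟨‖(matL2 A : L2 𝕋 ι →L[ℝ] L2 𝕋 κ)‖ + 1, by positivity, fun u =>
    ⟨matL2 A u, incl_matL2 A u, (ContinuousLinearMap.le_opNorm _ u).trans ?_⟩⟩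
  gcongr
  linarith

/-- The homotopy argument for integral quadratic constraints: an a priori bound on the finite
energy solutions of the scaled loops, uniform in the scaling, implies that the solutions have
finite energy. -/
theorem exists_incl_of_aprioriBound {G : Sig 𝕋 ι → Sig 𝕋 κ} {Δ : Sig 𝕋 κ → Sig 𝕋 ι}
    (hG : IsCausal G) (hGb : IsBounded G) (hΔ : IsCausal Δ) (hΔb : IsBounded Δ)
    (hwp : ∀ a ∈ Set.Icc (0 : ℝ) 1, LoopWellPosed G (fun y => a • Δ y)) {C : ℝ}
    (hC : ∀ a ∈ Set.Icc (0 : ℝ) 1, ∀ e d : L2 𝕋 ι,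
      incl e = a • Δ (G (incl e)) + incl d → ‖e‖ ≤ C * ‖d‖) (d : L2 𝕋 ι) :
    ∃ e : L2 𝕋 ι, incl e = Δ (G (incl e)) + incl d ∧ ‖e‖ ≤ C * ‖d‖ := by
  obtain ⟨γ, hγ, hγb⟩ := hΔb.comp hGb
  have hcl : ∀ a ∈ Set.Icc (0 : ℝ) 1, ∃ E : Sig 𝕋 ι → Sig 𝕋 ι, IsCausal E ∧
      ∀ d e, e = a • Δ (G e) + d ↔ e = E d := fun a ha => (hwp a ha).exists_closedLoop
  -- Once every finite energy `d` has a finite energy solution at `a`, the a priori bound is a gain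
  -- bound for the closed-loop map, and causality extends it to truncations of arbitrary extended
  -- solutions.
  have htrunc : ∀ a ∈ Set.Icc (0 : ℝ) 1,
      (∀ d : L2 𝕋 ι, ∃ e : L2 𝕋 ι, incl e = a • Δ (G (incl e)) + incl d) →
      ∀ (d e : Sig 𝕋 ι) τ, e = a • Δ (G e) + d → ‖truncL2 τ e‖ ≤ C * ‖truncL2 τ d‖ := by
    intro a ha h d e τ hde
    obtain ⟨E, hEc, hE⟩ := hcl a ha
    rw [(hE d e).1 hde]
    refine hEc.norm_truncL2_le (fun u => ?_) τ d
    obtain ⟨x, hx⟩ := h u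
    exact ⟨x, (hE _ _).1 hx, hC a ha x u hx⟩
  -- Homotopy steps of length `1 / n` have loop gain `|C| γ / n` at most one half.
  obtain ⟨n, hn⟩ := exists_nat_gt (2 * |C| * γ)
  have hn0 : (0 : ℝ) < n := lt_of_le_of_lt (by positivity) hn
  have key : ∀ k : ℕ, k ≤ n → ∀ d : L2 𝕋 ι, ∃ e : L2 𝕋 ι,
      incl e = ((k : ℝ) / n) • Δ (G (incl e)) + incl d := by
    intro k
    induction k with
    | zero => exact fun _ d => ⟨d, by simp⟩
    | succ k ih =>
      intro hk d
      have hmem : ∀ j : ℕ, j ≤ n → (j : ℝ) / n ∈ Set.Icc (0 : ℝ) 1 := fun j hj =>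
        ⟨by positivity, (div_le_one hn0).2 (by exact_mod_cast hj)⟩
      have hk' : k ≤ n := by omega
      obtain ⟨E, -, hE⟩ := hcl _ (hmem (k + 1) hk)
      have he := (hE (incl d) _).2 rfl
      set e := E (incl d)
      have hbound : ∀ τ, ‖truncL2 τ e‖ ≤ 2 * (|C| * ‖d‖) := by
        intro τ
        -- A solution at the next parameter solves the current loop with the increment as an extra
        -- disturbance; by small gain its contribution is absorbed on the left.
        have h1 : e = ((k : ℝ) / n) • Δ (G e) + ((1 / (n : ℝ)) • Δ (G e) + incl d) := by
          rw [← add_assoc, ← add_smul, ← add_div]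
          exact_mod_cast he
        have h2 := htrunc _ (hmem k hk') (ih hk') _ e τ h1
        have h3 : ‖truncL2 τ ((1 / (n : ℝ)) • Δ (G e) + incl d)‖
            ≤ 1 / (n : ℝ) * (γ * ‖truncL2 τ e‖) + ‖d‖ := by
          rw [map_add, map_smul]
          refine (norm_add_le _ _).trans (add_le_add ?_ (norm_truncL2_incl_le τ d))
          rw [norm_smul, Real.norm_of_nonneg (by positivity)]
          gcongr
          exact (hΔ.comp hG).norm_truncL2_le hγb τ e
        have h4 : |C| * (1 / (n : ℝ) * γ) ≤ 1 / 2 := by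
          rw [one_div, mul_left_comm, inv_mul_le_iff₀ hn0]
          linarith
        have h5 : ‖truncL2 τ e‖ ≤ |C| * (1 / (n : ℝ) * (γ * ‖truncL2 τ e‖) + ‖d‖) :=
          h2.trans (mul_le_mul (le_abs_self C) h3 (norm_nonneg _) (abs_nonneg C))
        have h6 := mul_le_mul_of_nonneg_right h4 (norm_nonneg (truncL2 τ e))
        linarith
      obtain ⟨x, hx⟩ := exists_incl_of_norm_truncL2_le hbound
      exact ⟨x, by rw [hx]; exact_mod_cast he⟩
  obtain ⟨e, he⟩ := key n le_rfl d
  rw [div_self hn0.ne'] at he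
  refine ⟨e, by simpa using he, hC 1 (by simp) e d he⟩

end Signals

/-! ### Quadratic forms: change of variables and perturbation. -/

section Blocks

variable {E F : Type} [NormedAddCommGroup E] [InnerProductSpace ℝ E] [CompleteSpace E]
  [NormedAddCommGroup F] [InnerProductSpace ℝ F] [CompleteSpace F]

theorem blockForm_eq (A : E →L[ℝ] E) (B : F →L[ℝ] E) (C : F →L[ℝ] F) (y : E) (u : F) :
    blockForm A B C y u = ⟪y, A y⟫_ℝ + 2 * ⟪y, B u⟫_ℝ + ⟪u, C u⟫_ℝ := by
  rw [blockForm, inner_add_right, inner_add_right, ContinuousLinearMap.adjoint_inner_right,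
    real_inner_comm y (B u)]
  ring

/-- The congruence by `(N, 0; J, -I)` that defines the transformed multiplier. Self-adjointness of
`Pi₃` merges the two cross terms between `J x` and `q`. -/
theorem blockForm_coprime (N : F →L[ℝ] E) (J : F →L[ℝ] F) (Pi₁ : E →L[ℝ] E) (Pi₂ : F →L[ℝ] E)
    {Pi₃ : F →L[ℝ] F} (h₃ : IsSelfAdjoint Pi₃) (x q : F) :
    blockForm Pi₁ Pi₂ Pi₃ (N x) (J x - q) =
      blockForm (psiOne N J Pi₁ Pi₂ Pi₃) (psiTwo N J Pi₂ Pi₃) Pi₃ x q := by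
  have h₃' : ⟪q, Pi₃ (J x)⟫_ℝ = ⟪J x, Pi₃ q⟫_ℝ := by
    rw [real_inner_comm, ← ContinuousLinearMap.adjoint_inner_right, h₃.adjoint_eq]
  simp only [blockForm_eq, psiOne, psiTwo, add_apply,
    neg_apply, ContinuousLinearMap.comp_apply, map_sub, inner_add_right,
    inner_sub_right, inner_sub_left, inner_neg_right, ContinuousLinearMap.adjoint_inner_right,
    map_add, h₃']
  rw [real_inner_comm (Pi₂ (J x)) (N x)]
  ring

/-- Every term of the difference contains `d`, so Cauchy–Schwarz applies. This compares the link
constraint, known at `e - d`, with the network constraint, known at `e`. -/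
theorem exists_blockForm_sub_le (A : E →L[ℝ] E) (B : F →L[ℝ] E) (C : F →L[ℝ] F) :
    ∃ K : ℝ, 0 ≤ K ∧ ∀ (y : E) (u d : F),
      blockForm A B C y (u - d) ≤ blockForm A B C y u + K * ((‖y‖ + ‖u‖ + ‖d‖) * ‖d‖) := by
  refine ⟨2 * ‖B‖ + 2 * ‖C‖, by positivity, fun y u d => ?_⟩
  have hB : -⟪y, B d⟫_ℝ ≤ ‖B‖ * (‖y‖ * ‖d‖) := by
    refine (neg_le_abs _).trans ((abs_real_inner_le_norm _ _).trans ?_)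
    calc ‖y‖ * ‖B d‖ ≤ ‖y‖ * (‖B‖ * ‖d‖) := by gcongr; exact B.le_opNorm d
      _ = _ := by ring
  have hC (v w : F) : |⟪v, C w⟫_ℝ| ≤ ‖C‖ * (‖v‖ * ‖w‖) := by
    refine (abs_real_inner_le_norm _ _).trans ?_
    calc ‖v‖ * ‖C w‖ ≤ ‖v‖ * (‖C‖ * ‖w‖) := by gcongr; exact C.le_opNorm w
      _ = _ := by ring
  have h1 := (neg_le_abs _).trans (hC u d)
  have h2 := (neg_le_abs _).trans (hC d u)
  have h3 := (le_abs_self _).trans (hC d d)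
  simp only [blockForm_eq, map_sub, inner_sub_right, inner_sub_left]
  have p1 : 0 ≤ ‖B‖ * (‖u‖ * ‖d‖) := by positivity
  have p2 : 0 ≤ ‖B‖ * (‖d‖ * ‖d‖) := by positivity
  have p3 : 0 ≤ ‖C‖ * (‖y‖ * ‖d‖) := by positivity
  have p4 : 0 ≤ ‖C‖ * (‖d‖ * ‖d‖) := by positivity
  have h2' : -⟪d, C u⟫_ℝ ≤ ‖C‖ * (‖u‖ * ‖d‖) := by rwa [mul_comm ‖u‖]
  linarith

end Blocks

/-! ### Blocks of direct sums. -/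

section DirectSums

variable {𝕋 : TimeDomain} {I : Type} {α β : I → Type}

@[simp]
theorem blockL2_apply (i : I) (u : L2 𝕋 (Σ i, α i)) (a : α i) :
    blockL2 i u a = u ⟨i, a⟩ := rfl

theorem directSumL2_apply [∀ i, Fintype (α i)] [∀ i, Fintype (β i)]
    (A : ∀ i, L2 𝕋 (α i) →L[ℝ] L2 𝕋 (β i)) (u : L2 𝕋 (Σ i, α i))
    (x : Σ i, β i) : directSumL2 A u x = A x.1 (blockL2 x.1 u) x.2 := rfl

theorem blockL2_directSumL2 [∀ i, Fintype (α i)] [∀ i, Fintype (β i)]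
    (A : ∀ i, L2 𝕋 (α i) →L[ℝ] L2 𝕋 (β i)) (u : L2 𝕋 (Σ i, α i))
    (i : I) : blockL2 i (directSumL2 A u) = A i (blockL2 i u) := rfl

end DirectSums

/-! ### Matrices and inner products on finite energy signals. -/

section Matrices

variable {𝕋 : TimeDomain} {ι κ μ : Type} [Fintype ι] [Fintype κ] [Fintype μ]

theorem matL2_apply (A : Matrix κ ι ℝ) (u : L2 𝕋 ι) (r : κ) :
    matL2 A u r = ∑ s, A r s • u s := by
  simp [matL2]

theorem matL2_sum {S : Type} (s : Finset S) (A : S → Matrix κ ι ℝ) :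
    (matL2 (∑ k ∈ s, A k) : L2 𝕋 ι →L[ℝ] L2 𝕋 κ) = ∑ k ∈ s, matL2 (A k) := by
  ext1 u
  ext1 r
  simp only [matL2_apply, sum_apply, Matrix.sum_apply, Finset.sum_smul,
    WithLp.ofLp_sum, Finset.sum_apply]
  exact Finset.sum_comm

theorem matL2_smul (a : ℝ) (A : Matrix κ ι ℝ) :
    (matL2 (a • A) : L2 𝕋 ι →L[ℝ] L2 𝕋 κ) = a • matL2 A := by
  ext1 u
  ext1 r
  simp [matL2_apply, Finset.smul_sum, smul_smul]

theorem matL2_matL2 (A : Matrix μ κ ℝ) (B : Matrix κ ι ℝ) (u : L2 𝕋 ι) :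
    matL2 A (matL2 B u) = matL2 (A * B) u := by
  ext1 r
  simp only [matL2_apply, Matrix.mul_apply, Finset.sum_smul, Finset.smul_sum, smul_smul]
  exact Finset.sum_comm

theorem inner_matL2 (A : Matrix κ ι ℝ) (v : L2 𝕋 κ) (u : L2 𝕋 ι) :
    ⟪v, matL2 A u⟫_ℝ = ⟪matL2 A.transpose v, u⟫_ℝ := by
  simp only [PiLp.inner_apply, matL2_apply, inner_sum, sum_inner, inner_smul_left,
    inner_smul_right, Matrix.transpose_apply, conj_trivial]
  exact Finset.sum_comm

variable {I : Type} [Fintype I] {α : I → Type} [∀ i, Fintype (α i)]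

theorem inner_eq_sum_blockL2 (u v : L2 𝕋 (Σ i, α i)) :
    ⟪u, v⟫_ℝ = ∑ i, ⟪blockL2 i u, blockL2 i v⟫_ℝ := by
  simp only [PiLp.inner_apply, blockL2_apply]
  exact Fintype.sum_sigma _

theorem norm_sq_eq_sum_blockL2 (u : L2 𝕋 (Σ i, α i)) :
    ‖u‖ ^ 2 = ∑ i, ‖blockL2 i u‖ ^ 2 := by
  simp only [← real_inner_self_eq_norm_sq]
  exact inner_eq_sum_blockL2 u u

theorem norm_blockL2_le (u : L2 𝕋 (Σ i, α i)) (i : I) : ‖blockL2 i u‖ ≤ ‖u‖ := by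
  refine le_of_sq_le_sq ?_ (norm_nonneg u)
  rw [norm_sq_eq_sum_blockL2 u]
  exact Finset.single_le_sum (f := fun i => ‖blockL2 i u‖ ^ 2)
    (fun _ _ => by positivity) (Finset.mem_univ i)

end Matrices

/-! ### Edge Laplacians and their localization. -/

section Laplacian

theorem incidence_eq_zero {V : Type} [LinearOrder V] {Γ : SimpleGraph V} {r : Port Γ}
    {k : Sym2 V} (h : r.1 ∉ k) : incidence Γ r k = 0 := by
  rw [incidence, if_neg]
  rintro rfl
  exact h (Sym2.mem_mk_left _ _)

variable {V : Type} [Fintype V] [LinearOrder V] (Γ : SimpleGraph V) [DecidableRel Γ.Adj]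

/-- The Laplacian of the edge `k` on all ports. -/
def edgeLap (k : Sym2 V) : Matrix (Port Γ) (Port Γ) ℝ :=
  Matrix.vecMulVec (fun r => incidence Γ r k) (fun r => incidence Γ r k)

variable {Γ}

/-- Each port lies on exactly one edge, and on the two ports of an edge the Laplacian is `(1, -1;
-1, 1)`, the identity minus the swap. -/
theorem sum_edgeLap : ∑ k ∈ Γ.edgeFinset, edgeLap Γ k = 1 - routing Γ := by
  ext ⟨i, j, hj⟩ ⟨i', j', hj'⟩
  have hij : Γ.Adj i j := hj
  have hij' : Γ.Adj i' j' := hj'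
  rw [Matrix.sum_apply, Finset.sum_eq_single s(i, j)]
  · simp only [edgeLap, Matrix.vecMulVec_apply, incidence, Matrix.sub_apply,
      Matrix.one_apply, routing, Sigma.mk.injEq, Sym2.eq_iff]
    by_cases h1 : i' = i
    · subst h1
      by_cases h2 : j' = j
      · subst h2
        have : ¬ (i' = j' ∧ j' = i') := fun h => hij.ne h.1
        by_cases hlt : i' < j' <;> simp [this, hlt]
      · have h3 : ¬ i' = j := hij.ne
        have : ¬ j = j' := fun h => h2 h.symm
        simp [h2, h3, this]
    · by_cases h2 : i' = j ∧ j' = i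
      · obtain ⟨rfl, rfl⟩ := h2
        have h1' : ¬ j' = i' := fun h => h1 h.symm
        rcases lt_or_gt_of_ne h1 with h | h <;> simp [h, h.not_gt, h1']
      · have h1' : ¬ i = i' := fun h => h1 h.symm
        simp [h1, h1', h2]
  · intro k _ hk
    simp [edgeLap, Matrix.vecMulVec_apply, incidence, hk.symm]
  · intro h
    exact absurd (by simpa using hij) h

variable {c : ℕ} {F : Fin c → Finset (Sym2 V)} {p : Fin c}

theorem mem_partVerts (hF : ∀ p, F p ⊆ Γ.edgeFinset) {k : Sym2 V} (hk : k ∈ F p) {i : V}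
    (hi : i ∈ k) : i ∈ partVerts Γ F p := by
  have hE : k ∈ Γ.edgeSet := by simpa using hF p hk
  rw [partVerts, Finset.mem_filter]
  refine ⟨Finset.mem_univ _, k, Finset.mem_inter.2 ⟨?_, hk⟩⟩
  rw [SimpleGraph.mem_incidenceFinset]
  exact ⟨hE, hi⟩

theorem sum_partVerts {M : Type} [AddCommMonoid M] {g : V → M}
    (hg : ∀ i, i ∉ partVerts Γ F p → g i = 0) :
    ∑ i : partVerts Γ F p, g i = ∑ i, g i := by
  rw [Finset.sum_coe_sort (partVerts Γ F p) g]
  exact Finset.sum_subset (Finset.subset_univ _) fun i _ hi => hg i hi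

/-- Incidence columns of distinct edges have disjoint supports. The column of `k` has squared length
`2`, because both endpoints of `k`, hence both of its ports, are local. -/
theorem localLap_mul_localLap (hF : ∀ p, F p ⊆ Γ.edgeFinset) {k l : Sym2 V}
    (hk : k ∈ F p) :
    localLap Γ F p k * localLap Γ F p l = if k = l then (2 : ℝ) • localLap Γ F p k else 0 := by
  rw [localLap, localLap, Matrix.vecMulVec_mul_vecMulVec]
  split_ifs with h
  · subst h
    have h2 : localIncidence Γ F p k ⬝ᵥ localIncidence Γ F p k = 2 := by
      induction k using Sym2.ind with
      | _ a b =>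
        have hab : Γ.Adj a b := by simpa using hF p hk
        have ha := mem_partVerts hF hk (Sym2.mem_mk_left a b)
        have hb := mem_partVerts hF hk (Sym2.mem_mk_right a b)
        let x : LocalPort Γ F p := ⟨⟨a, ha⟩, ⟨b, hab⟩⟩
        let y : LocalPort Γ F p := ⟨⟨b, hb⟩, ⟨a, hab.symm⟩⟩
        have hxy : x ≠ y := fun h =>
          hab.ne (congrArg (fun r : LocalPort Γ F p => (r.1 : V)) h)
        rw [dotProduct, ← Finset.sum_subset (Finset.subset_univ {x, y}), Finset.sum_pair hxy]
        · rcases lt_or_gt_of_ne hab.ne with h | h <;>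
            simp [localIncidence, incidence, x, y, h, h.not_gt, Sym2.eq_swap] <;> norm_num
        · rintro ⟨⟨i, hi⟩, ⟨j, hj⟩⟩ _ hr
          have : ¬ s(i, j) = s(a, b) := by
            intro h
            rcases Sym2.eq_iff.1 h with ⟨rfl, rfl⟩ | ⟨rfl, rfl⟩
            · exact hr (by simp [x])
            · exact hr (by simp [y])
          simp [localIncidence, incidence, this]
    rw [h2]
    ext r s
    simp only [Matrix.vecMulVec_apply, Pi.smul_apply, Matrix.smul_apply, smul_eq_mul]
    ring
  · have h0 : localIncidence Γ F p k ⬝ᵥ localIncidence Γ F p l = 0 := by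
      refine Finset.sum_eq_zero fun r _ => ?_
      simp only [localIncidence, incidence]
      by_cases h1 : s((r.1 : V), (r.2 : V)) = k
      · have h2 : ¬ s((r.1 : V), (r.2 : V)) = l := fun h2 => h (h1.symm.trans h2)
        simp [h2]
      · simp [h1]
    rw [h0]
    ext r s
    simp [Matrix.vecMulVec_apply]

variable {𝕋 : TimeDomain}

variable (F p) in
/-- The restriction of a signal to the ports of the agents in an element of the partition. -/
def restrictPorts (u : L2 𝕋 (Port Γ)) : L2 𝕋 (LocalPort Γ F p) :=
  WithLp.toLp 2 fun r => u ⟨r.1, r.2⟩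

/-- The Laplacian of an edge in `F p` reads only ports at its endpoints, all of them local, so
restriction loses nothing. -/
theorem matL2_localLap_restrictPorts (hF : ∀ p, F p ⊆ Γ.edgeFinset) {k : Sym2 V} (hk : k ∈ F p)
    (u : L2 𝕋 (Port Γ)) :
    matL2 (localLap Γ F p k) (restrictPorts F p u) =
      restrictPorts F p (matL2 (edgeLap Γ k) u) := by
  ext1 r
  refine (matL2_apply _ _ _).trans (Eq.trans ?_ (matL2_apply _ _ _).symm)
  simp only [Fintype.sum_sigma]
  refine Eq.trans ?_ (sum_partVerts (Γ := Γ) (F := F) (p := p) (g := fun i : V => ∑ j : Nbr Γ i,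
    edgeLap Γ k ⟨r.1, r.2⟩ ⟨i, j⟩ • u ⟨i, j⟩) fun i hi => ?_)
  · rfl
  · refine Finset.sum_eq_zero fun j _ => ?_
    have : incidence Γ ⟨i, j⟩ k = 0 :=
      incidence_eq_zero (Γ := Γ) (r := ⟨i, j⟩) fun h => hi (mem_partVerts hF hk h)
    simp [edgeLap, Matrix.vecMulVec_apply, this]

theorem blockL2_edgeLap {k : Sym2 V} {i : V} (hi : i ∉ k) (u : L2 𝕋 (Port Γ)) :
    blockL2 i (matL2 (edgeLap Γ k) u) = 0 := by
  ext1 a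
  rw [blockL2_apply, matL2_apply, PiLp.zero_apply]
  refine Finset.sum_eq_zero fun s _ => ?_
  have : incidence Γ ⟨i, a⟩ k = 0 := incidence_eq_zero (Γ := Γ) (r := ⟨i, a⟩) hi
  simp [edgeLap, Matrix.vecMulVec_apply, this]

end Laplacian

/-! ### Weighted counting over overlapping partition elements. -/

section Counting

variable {V : Type} [Fintype V] [LinearOrder V] {Γ : SimpleGraph V} [DecidableRel Γ.Adj]
  {c : ℕ} {F : Fin c → Finset (Sym2 V)}

/-- Weighted sums over the elements of a partition, each element weighted by the number of its
occurrences. -/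
theorem sum_sum_one_div_card {S P : Type} [Fintype P] [DecidableEq S] (A : P → Finset S)
    (B : Finset S) (hA : ∀ p, A p ⊆ B) (hcov : ∀ x ∈ B, ∃ p, x ∈ A p) (g : S → ℝ) :
    ∑ p, ∑ x ∈ A p, 1 / ((Finset.univ.filter fun p => x ∈ A p).card : ℝ) * g x =
      ∑ x ∈ B, g x := by
  have h1 (p : P) : ∑ x ∈ A p, 1 / ((Finset.univ.filter fun p => x ∈ A p).card : ℝ) * g x =
      ∑ x ∈ B, if x ∈ A p then
        1 / ((Finset.univ.filter fun p => x ∈ A p).card : ℝ) * g x else 0 := by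
    rw [← Finset.sum_filter, Finset.filter_mem_eq_inter, Finset.inter_eq_right.2 (hA p)]
  simp only [h1]
  rw [Finset.sum_comm]
  refine Finset.sum_congr rfl fun x hx => ?_
  obtain ⟨p, hp⟩ := hcov x hx
  have hne : ((Finset.univ.filter fun p => x ∈ A p).card : ℝ) ≠ 0 := by
    rw [Nat.cast_ne_zero, Finset.card_ne_zero]
    exact ⟨p, by simpa using hp⟩
  rw [← Finset.sum_filter, Finset.sum_const, nsmul_eq_mul]
  field_simp

theorem sum_edgeParts (hF : IsLocalizedEdgePartition Γ F) (g : Sym2 V → ℝ) :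
    ∑ p, ∑ k ∈ F p, 1 / ((edgeParts F k).card : ℝ) * g k = ∑ k ∈ Γ.edgeFinset, g k :=
  sum_sum_one_div_card F _ hF.subset hF.cover g

theorem adjEdges_subset (k : Sym2 V) : adjEdges Γ k ⊆ Γ.edgeFinset := by
  intro l hl
  simp only [adjEdges, Finset.mem_sdiff, Finset.mem_biUnion, SimpleGraph.mem_incidenceFinset]
    at hl
  obtain ⟨⟨i, -, hi⟩, -⟩ := hl
  simpa using hi.1

theorem sum_edgePairParts (hF : IsLocalizedEdgePartition Γ F) (hcov : CoversAdjacentEdges Γ F)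
    (g : Sym2 V → Sym2 V → ℝ) :
    ∑ p, ∑ k ∈ F p, ∑ l ∈ F p ∩ adjEdges Γ k, 1 / ((edgePairParts F k l).card : ℝ) * g k l =
      ∑ k ∈ Γ.edgeFinset, ∑ l ∈ adjEdges Γ k, g k l := by
  have h1 (p : Fin c) (k : Sym2 V) (hk : k ∈ Γ.edgeFinset) : (if k ∈ F p then
      ∑ l ∈ F p ∩ adjEdges Γ k, 1 / ((edgePairParts F k l).card : ℝ) * g k l else 0) =
      ∑ l ∈ (if k ∈ F p then F p ∩ adjEdges Γ k else ∅),
        1 / ((edgePairParts F k l).card : ℝ) * g k l := by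
    split_ifs <;> simp
  have h2 (p : Fin c) : ∑ k ∈ F p, ∑ l ∈ F p ∩ adjEdges Γ k,
      1 / ((edgePairParts F k l).card : ℝ) * g k l = ∑ k ∈ Γ.edgeFinset,
      ∑ l ∈ (if k ∈ F p then F p ∩ adjEdges Γ k else ∅),
        1 / ((edgePairParts F k l).card : ℝ) * g k l := by
    rw [← Finset.sum_congr rfl (h1 p), ← Finset.sum_filter, Finset.filter_mem_eq_inter,
      Finset.inter_eq_right.2 (hF.subset p)]
  simp only [h2]
  rw [Finset.sum_comm]
  refine Finset.sum_congr rfl fun k hk => ?_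
  -- For fixed `k`, the number of these sets containing an adjacent edge `l` is the number of
  -- elements containing both edges; the covering hypothesis makes it nonzero.
  rw [← sum_sum_one_div_card (fun p => if k ∈ F p then F p ∩ adjEdges Γ k else ∅)
    (adjEdges Γ k) _ _ (g k)]
  · refine Finset.sum_congr rfl fun p _ => Finset.sum_congr rfl fun l hl => ?_
    have hl' : l ∈ adjEdges Γ k := by
      split_ifs at hl
      · exact (Finset.mem_inter.1 hl).2
      · simp at hl
    congr 3
    refine congrArg Finset.card (Finset.filter_congr fun q _ => ?_)
    split_ifs with hq <;> simp [hq, hl']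
  · intro p
    split_ifs
    · exact Finset.inter_subset_right
    · exact Finset.empty_subset _
  · intro l hl
    have h3 := hcov k hk hl
    simp only [Finset.mem_sdiff, Finset.mem_biUnion, edgeParts, Finset.mem_filter,
      Finset.mem_univ, true_and] at h3
    obtain ⟨⟨p, hp, hlp⟩, -⟩ := h3
    exact ⟨p, by simp [hp, hlp, hl]⟩

/-- An agent with a neighbour lies on an edge, hence in some element of the partition, so its weight
is not a division by zero. -/
theorem sum_vertParts (hF : IsLocalizedEdgePartition Γ F) (hΓ : ∀ i : V, ∃ j, Γ.Adj i j)
    (g : V → ℝ) :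
    ∑ p, ∑ i : partVerts Γ F p, 1 / ((vertParts Γ F i).card : ℝ) * g i = ∑ i, g i := by
  rw [← sum_sum_one_div_card (partVerts Γ F) Finset.univ (fun _ => Finset.subset_univ _) _ g]
  · refine Finset.sum_congr rfl fun p _ => ?_
    rw [Finset.sum_coe_sort (partVerts Γ F p)
      (fun i => 1 / ((vertParts Γ F i).card : ℝ) * g i)]
    simp [partVerts, vertParts]
  · intro i _
    obtain ⟨j, hj⟩ := hΓ i
    obtain ⟨p, hp⟩ := hF.cover s(i, j) (by simpa using hj)
    exact ⟨p, mem_partVerts hF.subset hp (Sym2.mem_mk_left i j)⟩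

end Counting

/-! ### Assembly of the local quadratic forms. -/

section LocalForms

variable {𝕋 : TimeDomain} {V : Type} [Fintype V] [LinearOrder V] {Γ : SimpleGraph V}
  [DecidableRel Γ.Adj] {c : ℕ} {F : Fin c → Finset (Sym2 V)}

theorem inner_restrictPorts_localSum (p : Fin c)
    (A : ∀ i, L2 𝕋 (Nbr Γ i) →L[ℝ] L2 𝕋 (Nbr Γ i)) (u v : L2 𝕋 (Port Γ)) :
    ⟪restrictPorts F p u, localSum F p A (restrictPorts F p v)⟫_ℝ =
      ∑ i : partVerts Γ F p, ⟪blockL2 (i : V) u, A i (blockL2 (i : V) v)⟫_ℝ := by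
  rw [inner_eq_sum_blockL2]
  rfl

/-- The image of the Laplacian of `k` vanishes at agents off `k`, so the sum over local agents
extends to all agents. -/
theorem inner_restrictPorts_localSum_edgeLap (hF : ∀ p, F p ⊆ Γ.edgeFinset) {p : Fin c}
    (A : ∀ i, L2 𝕋 (Nbr Γ i) →L[ℝ] L2 𝕋 (Nbr Γ i)) (u f : L2 𝕋 (Port Γ)) {k : Sym2 V}
    (hk : k ∈ F p) :
    ⟪restrictPorts F p u, localSum F p A (restrictPorts F p (matL2 (edgeLap Γ k) f))⟫_ℝ =
      ⟪u, directSumL2 A (matL2 (edgeLap Γ k) f)⟫_ℝ := by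
  rw [inner_restrictPorts_localSum, inner_eq_sum_blockL2]
  refine sum_partVerts (F := F) (p := p)
    (g := fun i => ⟪blockL2 i u, A i (blockL2 i (matL2 (edgeLap Γ k) f))⟫_ℝ) fun i hi => ?_
  rw [blockL2_edgeLap fun h => hi (mem_partVerts hF hk h), map_zero, inner_zero_right]

theorem localK_restrictPorts (p : Fin c)
    (D : ∀ i, L2 𝕋 (Nbr Γ i) →L[ℝ] L2 𝕋 (Nbr Γ i)) (z : L2 𝕋 (Port Γ)) :
    localK F p D (restrictPorts F p z) =
      matL2 (∑ k ∈ F p, localLap Γ F p k) (restrictPorts F p (directSumL2 D z)) := rfl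

/-- Multiplying `K̂` by one local Laplacian isolates that edge. The factor `2` is what the
coefficients `1/2` and `1/4` of the local constraint compensate. -/
theorem matL2_localLap_localK (hF : ∀ p, F p ⊆ Γ.edgeFinset) {p : Fin c}
    (D : ∀ i, L2 𝕋 (Nbr Γ i) →L[ℝ] L2 𝕋 (Nbr Γ i)) (z : L2 𝕋 (Port Γ)) {k : Sym2 V}
    (hk : k ∈ F p) :
    matL2 (localLap Γ F p k) (localK F p D (restrictPorts F p z)) =
      (2 : ℝ) • restrictPorts F p (matL2 (edgeLap Γ k) (directSumL2 D z)) := by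
  rw [localK_restrictPorts, matL2_matL2, Finset.mul_sum,
    Finset.sum_congr rfl fun l _ => localLap_mul_localLap hF (l := l) hk, Finset.sum_ite_eq,
    if_pos hk, matL2_smul, smul_apply, matL2_localLap_restrictPorts hF hk]

theorem blockForm_local_eq (hF : ∀ p, F p ⊆ Γ.edgeFinset) (p : Fin c) (ε : ℝ)
    (D Ψ₁ Ψ₂ Ψ₃ : ∀ i, L2 𝕋 (Nbr Γ i) →L[ℝ] L2 𝕋 (Nbr Γ i)) (z : L2 𝕋 (Port Γ)) :
    blockForm (localX F p Ψ₁ + ε • localW Γ F p) ((1 / 2 : ℝ) • localY F p Ψ₂)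
        ((1 / 4 : ℝ) • localZ F p Ψ₃) (restrictPorts F p z)
        (localK F p D (restrictPorts F p z)) =
      ∑ i : partVerts Γ F p, 1 / ((vertParts Γ F i).card : ℝ) *
        (⟪blockL2 (i : V) z, Ψ₁ i (blockL2 (i : V) z)⟫_ℝ + ε * ‖blockL2 (i : V) z‖ ^ 2) +
      2 * ∑ k ∈ F p, 1 / ((edgeParts F k).card : ℝ) *
        ⟪z, directSumL2 Ψ₂ (matL2 (edgeLap Γ k) (directSumL2 D z))⟫_ℝ +
      (∑ k ∈ F p, 1 / ((edgeParts F k).card : ℝ) *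
        ⟪matL2 (edgeLap Γ k) (directSumL2 D z),
          directSumL2 Ψ₃ (matL2 (edgeLap Γ k) (directSumL2 D z))⟫_ℝ +
      ∑ k ∈ F p, ∑ l ∈ F p ∩ adjEdges Γ k, 1 / ((edgePairParts F k l).card : ℝ) *
        ⟪matL2 (edgeLap Γ k) (directSumL2 D z),
          directSumL2 Ψ₃ (matL2 (edgeLap Γ l) (directSumL2 D z))⟫_ℝ) := by
  rw [blockForm_eq]
  have hK {k : Sym2 V} (hk : k ∈ F p) := matL2_localLap_localK hF D z hk
  set K := localK F p D (restrictPorts F p z)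
  have hX : ⟪restrictPorts F p z, (localX F p Ψ₁ + ε • localW Γ F p :
      L2 𝕋 (LocalPort Γ F p) →L[ℝ] _) (restrictPorts F p z)⟫_ℝ =
      ∑ i : partVerts Γ F p, 1 / ((vertParts Γ F i).card : ℝ) *
        (⟪blockL2 (i : V) z, Ψ₁ i (blockL2 (i : V) z)⟫_ℝ + ε * ‖blockL2 (i : V) z‖ ^ 2) := by
    rw [add_apply, smul_apply, inner_add_right, inner_smul_right, localX,
      localW, inner_restrictPorts_localSum, inner_restrictPorts_localSum, Finset.mul_sum,
      ← Finset.sum_add_distrib]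
    refine Finset.sum_congr rfl fun i _ => ?_
    rw [smul_apply, smul_apply, inner_smul_right,
      inner_smul_right, ContinuousLinearMap.id_apply, real_inner_self_eq_norm_sq]
    ring
  have hY : ⟪restrictPorts F p z, ((1 / 2 : ℝ) • localY F p Ψ₂) K⟫_ℝ =
      ∑ k ∈ F p, 1 / ((edgeParts F k).card : ℝ) *
        ⟪z, directSumL2 Ψ₂ (matL2 (edgeLap Γ k) (directSumL2 D z))⟫_ℝ := by
    rw [smul_apply, inner_smul_right, localY, ContinuousLinearMap.comp_apply,
      matL2_sum, sum_apply, map_sum, inner_sum, Finset.mul_sum]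
    refine Finset.sum_congr rfl fun k hk => ?_
    rw [matL2_smul, smul_apply, hK hk, map_smul, map_smul, inner_smul_right,
      inner_smul_right, inner_restrictPorts_localSum_edgeLap hF Ψ₂ z _ hk]
    ring
  have hZ {k l : Sym2 V} (hk : k ∈ F p) (hl : l ∈ F p) :
      ⟪K, (matL2 (localLap Γ F p k) ∘L localSum F p Ψ₃ ∘L matL2 (localLap Γ F p l)) K⟫_ℝ =
        4 * ⟪matL2 (edgeLap Γ k) (directSumL2 D z),
          directSumL2 Ψ₃ (matL2 (edgeLap Γ l) (directSumL2 D z))⟫_ℝ := by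
    have ht : (localLap Γ F p k).transpose = localLap Γ F p k := by
      simp [localLap, Matrix.transpose_vecMulVec]
    rw [ContinuousLinearMap.comp_apply, ContinuousLinearMap.comp_apply, inner_matL2, ht, hK hk,
      hK hl, map_smul, inner_smul_left, inner_smul_right,
      inner_restrictPorts_localSum_edgeLap hF Ψ₃ _ _ hl, conj_trivial]
    ring
  rw [hX, hY, smul_apply, inner_smul_right, localZ, add_apply,
    inner_add_right, sum_apply, sum_apply, inner_sum, inner_sum, mul_add, Finset.mul_sum,
    Finset.mul_sum]
  refine congrArg₂ _ rfl (congrArg₂ _ ?_ ?_)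
  · refine Finset.sum_congr rfl fun k hk => ?_
    rw [smul_apply, inner_smul_right, hZ hk hk]
    ring
  · rw [Finset.mul_sum]
    refine Finset.sum_congr rfl fun k hk => ?_
    rw [sum_apply, inner_sum, Finset.mul_sum]
    refine Finset.sum_congr rfl fun l hl => ?_
    rw [smul_apply, inner_smul_right, hZ hk (Finset.mem_inter.1 hl).1]
    ring

/-- No agent lies on both edges, and a block diagonal operator does not couple different agents. -/
theorem inner_edgeLap_eq_zero {k l : Sym2 V} (hl : l ∈ Γ.edgeFinset) (hkl : l ≠ k)
    (h : l ∉ adjEdges Γ k) (A : ∀ i, L2 𝕋 (Nbr Γ i) →L[ℝ] L2 𝕋 (Nbr Γ i))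
    (f : L2 𝕋 (Port Γ)) :
    ⟪matL2 (edgeLap Γ k) f, directSumL2 A (matL2 (edgeLap Γ l) f)⟫_ℝ = 0 := by
  rw [inner_eq_sum_blockL2]
  refine Finset.sum_eq_zero fun i _ => ?_
  by_cases hk : i ∈ k
  · by_cases hil : i ∈ l
    · refine absurd ?_ h
      simp only [adjEdges, Finset.mem_sdiff, Finset.mem_biUnion, Sym2.mem_toFinset,
        SimpleGraph.mem_incidenceFinset, Finset.mem_singleton]
      exact ⟨⟨i, hk, by simpa using hl, hil⟩, hkl⟩
    · rw [blockL2_directSumL2, blockL2_edgeLap hil, map_zero, inner_zero_right]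
  · rw [blockL2_edgeLap hk, inner_zero_left]

/-- The sum of the local quadratic forms is the quadratic form of the network. -/
theorem sum_blockForm_local_eq (hF : IsLocalizedEdgePartition Γ F)
    (hcov : CoversAdjacentEdges Γ F) (hΓ : ∀ i : V, ∃ j, Γ.Adj i j) (ε : ℝ)
    (D Ψ₁ Ψ₂ Ψ₃ : ∀ i, L2 𝕋 (Nbr Γ i) →L[ℝ] L2 𝕋 (Nbr Γ i)) (z : L2 𝕋 (Port Γ)) :
    ∑ p, blockForm (localX F p Ψ₁ + ε • localW Γ F p) ((1 / 2 : ℝ) • localY F p Ψ₂)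
        ((1 / 4 : ℝ) • localZ F p Ψ₃) (restrictPorts F p z)
        (localK F p D (restrictPorts F p z)) =
      ∑ i, blockForm (Ψ₁ i) (Ψ₂ i) (Ψ₃ i) (blockL2 i z)
        (blockL2 i (directSumL2 D z - matL2 (routing Γ) (directSumL2 D z))) + ε * ‖z‖ ^ 2 := by
  simp only [blockForm_local_eq hF.subset, Finset.sum_add_distrib, ← Finset.mul_sum]
  rw [sum_vertParts hF hΓ fun i =>
      ⟪blockL2 i z, Ψ₁ i (blockL2 i z)⟫_ℝ + ε * ‖blockL2 i z‖ ^ 2,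
    sum_edgeParts hF fun k => ⟪z, directSumL2 Ψ₂ (matL2 (edgeLap Γ k) (directSumL2 D z))⟫_ℝ,
    sum_edgeParts hF fun k => ⟪matL2 (edgeLap Γ k) (directSumL2 D z),
      directSumL2 Ψ₃ (matL2 (edgeLap Γ k) (directSumL2 D z))⟫_ℝ,
    sum_edgePairParts hF hcov fun k l => ⟪matL2 (edgeLap Γ k) (directSumL2 D z),
      directSumL2 Ψ₃ (matL2 (edgeLap Γ l) (directSumL2 D z))⟫_ℝ]
  set f := directSumL2 D z
  have hq : f - matL2 (routing Γ) f = ∑ k ∈ Γ.edgeFinset, matL2 (edgeLap Γ k) f := by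
    rw [← sum_apply, ← matL2_sum, sum_edgeLap]
    ext1 r
    simp [matL2_apply, sub_smul, Finset.sum_sub_distrib, Matrix.one_apply]
  simp only [blockForm_eq, Finset.sum_add_distrib, ← Finset.mul_sum]
  rw [norm_sq_eq_sum_blockL2 z]
  have h2 : ∑ i, ⟪blockL2 i z, Ψ₂ i (blockL2 i (f - matL2 (routing Γ) f))⟫_ℝ =
      ∑ k ∈ Γ.edgeFinset, ⟪z, directSumL2 Ψ₂ (matL2 (edgeLap Γ k) f)⟫_ℝ := by
    rw [← inner_sum, ← map_sum, ← hq, inner_eq_sum_blockL2]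
    rfl
  have h3 : ∑ i, ⟪blockL2 i (f - matL2 (routing Γ) f),
        Ψ₃ i (blockL2 i (f - matL2 (routing Γ) f))⟫_ℝ =
      ∑ k ∈ Γ.edgeFinset,
        ⟪matL2 (edgeLap Γ k) f, directSumL2 Ψ₃ (matL2 (edgeLap Γ k) f)⟫_ℝ +
      ∑ k ∈ Γ.edgeFinset, ∑ l ∈ adjEdges Γ k,
        ⟪matL2 (edgeLap Γ k) f, directSumL2 Ψ₃ (matL2 (edgeLap Γ l) f)⟫_ℝ := by
    have h4 : ∑ i, ⟪blockL2 i (f - matL2 (routing Γ) f),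
        Ψ₃ i (blockL2 i (f - matL2 (routing Γ) f))⟫_ℝ =
        ⟪f - matL2 (routing Γ) f, directSumL2 Ψ₃ (f - matL2 (routing Γ) f)⟫_ℝ := by
      rw [inner_eq_sum_blockL2]
      rfl
    rw [h4, hq, map_sum, sum_inner, ← Finset.sum_add_distrib]
    refine Finset.sum_congr rfl fun k hk => ?_
    have hk' : k ∉ adjEdges Γ k := by simp [adjEdges]
    -- In the sum over `l`, only `l = k` and the edges adjacent to `k` survive.
    rw [inner_sum, ← Finset.sum_insert (f := fun l =>
      ⟪matL2 (edgeLap Γ k) f, directSumL2 Ψ₃ (matL2 (edgeLap Γ l) f)⟫_ℝ) hk', eq_comm]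
    refine Finset.sum_subset (Finset.insert_subset hk (adjEdges_subset k)) fun l hl hl' => ?_
    rw [Finset.mem_insert, not_or] at hl'
    exact inner_edgeLap_eq_zero hl hl'.1 hl'.2 Ψ₃ f
  rw [h2, h3]
  ring

/-- The local integral quadratic constraints imply a quadratic constraint on the graph of the
nominal network in terms of its coprime factors. -/
theorem exists_sum_blockForm_le (hF : IsLocalizedEdgePartition Γ F)
    (hcov : CoversAdjacentEdges Γ F) (hΓ : ∀ i : V, ∃ j, Γ.Adj i j)
    (N : ∀ i, L2 𝕋 (Nbr Γ i) →L[ℝ] L2 𝕋 Unit)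
    (D : ∀ i, L2 𝕋 (Nbr Γ i) →L[ℝ] L2 𝕋 (Nbr Γ i))
    (Pi₁ : V → (L2 𝕋 Unit →L[ℝ] L2 𝕋 Unit))
    (Pi₂ : ∀ i, L2 𝕋 (Nbr Γ i) →L[ℝ] L2 𝕋 Unit)
    (Pi₃ : ∀ i, L2 𝕋 (Nbr Γ i) →L[ℝ] L2 𝕋 (Nbr Γ i)) (hPi₃ : ∀ i, IsSelfAdjoint (Pi₃ i))
    (hloc : ∀ p, LocalIQC F p N D Pi₁ Pi₂ Pi₃) :
    ∃ ε : ℝ, 0 < ε ∧ ∀ z : L2 𝕋 (Port Γ),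
      ∑ i, blockForm (Pi₁ i) (Pi₂ i) (Pi₃ i) (N i (blockL2 i z))
        (agentJ N D i (blockL2 i z) -
          blockL2 i (directSumL2 D z - matL2 (routing Γ) (directSumL2 D z))) ≤
        -ε * ‖z‖ ^ 2 := by
  choose ε hε hle using hloc
  -- One margin for all local constraints: lowering `ε p` to the minimum only lowers the form, as
  -- its coefficient is a weighted sum of squared norms.
  obtain ⟨δ, hδ, hδε⟩ : ∃ δ : ℝ, 0 < δ ∧ ∀ p, δ ≤ ε p := by
    rcases isEmpty_or_nonempty (Fin c) with h | h
    · exact ⟨1, one_pos, fun p => h.elim p⟩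
    · obtain ⟨p, hp⟩ := Finite.exists_min ε
      exact ⟨ε p, hε p, hp⟩
  refine ⟨δ, hδ, fun z => ?_⟩
  simp only [blockForm_coprime _ _ _ _ (hPi₃ _)]
  have h := sum_blockForm_local_eq hF hcov hΓ δ D
    (fun i => psiOne (N i) (agentJ N D i) (Pi₁ i) (Pi₂ i) (Pi₃ i))
    (fun i => psiTwo (N i) (agentJ N D i) (Pi₂ i) (Pi₃ i)) Pi₃ z
  -- The local constraints are needed only at restrictions of one common signal `z`.
  have h' : _ ≤ (0 : ℝ) := h.symm.trans_le (Finset.sum_nonpos fun p _ =>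
    le_trans ?_ (hle p (restrictPorts F p z)))
  · linarith
  · simp only [blockForm_local_eq hF.subset]
    gcongr
    exact hδε p

end LocalForms

/-! ### Closure properties of causal and bounded maps. -/

section Combinators

variable {𝕋 : TimeDomain} {ι κ μ : Type}

theorem isCausal_coord_iff {G : Sig 𝕋 ι → Sig 𝕋 κ} :
    IsCausal G ↔ ∀ r, IsCausal fun u (_ : Unit) => G u r := by
  simp only [isCausal_iff, truncL2_eq_iff (ι := κ), truncL2_eq_iff (ι := Unit)]
  exact ⟨fun h r τ u v huv _ => h τ u v huv r, fun h τ u v huv r => h r τ u v huv ()⟩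

theorem isCausal_reindex (f : κ → ι) : IsCausal fun (u : Sig 𝕋 ι) r => u (f r) := by
  simp only [isCausal_iff, truncL2_eq_iff]
  exact fun τ u v h r => h (f r)

theorem IsCausal.reindex {G : Sig 𝕋 ι → Sig 𝕋 κ} (hG : IsCausal G) (f : μ → κ) :
    IsCausal fun u r => G u (f r) :=
  (isCausal_reindex f).comp hG

theorem isCausal_zero : IsCausal fun _ : Sig 𝕋 ι => (0 : Sig 𝕋 κ) :=
  isCausal_iff.2 fun _ _ _ _ => rfl

theorem IsCausal.add {G G' : Sig 𝕋 ι → Sig 𝕋 κ} (hG : IsCausal G) (hG' : IsCausal G') :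
    IsCausal fun u => G u + G' u := by
  rw [isCausal_iff] at *
  intro τ u v h
  rw [map_add, map_add, hG τ u v h, hG' τ u v h]

theorem IsCausal.sub {G G' : Sig 𝕋 ι → Sig 𝕋 κ} (hG : IsCausal G) (hG' : IsCausal G') :
    IsCausal fun u => G u - G' u := by
  rw [isCausal_iff] at *
  intro τ u v h
  rw [map_sub, map_sub, hG τ u v h, hG' τ u v h]

theorem IsCausal.sumElim {G : Sig 𝕋 ι → Sig 𝕋 κ} {G' : Sig 𝕋 ι → Sig 𝕋 μ} (hG : IsCausal G)
    (hG' : IsCausal G') : IsCausal fun u => (Sum.elim (G u) (G' u) : Sig 𝕋 (κ ⊕ μ)) := by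
  rw [isCausal_coord_iff] at *
  rintro (r | r)
  · exact hG r
  · exact hG' r

variable [Fintype ι] [Fintype κ] [Fintype μ]

theorem isBounded_coord_iff {G : Sig 𝕋 ι → Sig 𝕋 κ} :
    IsBounded G ↔ ∀ r, IsBounded fun u (_ : Unit) => G u r := by
  constructor
  · rintro ⟨γ, hγ, h⟩ r
    refine isBounded_of_coord fun _ => ⟨γ, fun u => ?_⟩
    obtain ⟨y, hy, hle⟩ := h u
    exact ⟨y r, congrFun hy r, (norm_coord_le y r).trans hle⟩
  · intro h
    refine isBounded_of_coord fun r => ?_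
    obtain ⟨γ, hγ, h⟩ := h r
    refine ⟨γ, fun u => ?_⟩
    obtain ⟨y, hy, hle⟩ := h u
    exact ⟨y (), congrFun hy (), (norm_coord_le y ()).trans hle⟩

theorem isBounded_reindex (f : κ → ι) : IsBounded fun (u : Sig 𝕋 ι) r => u (f r) :=
  isBounded_of_coord fun r => ⟨1, fun u => ⟨u (f r), rfl, by
    rw [one_mul]; exact norm_coord_le u (f r)⟩⟩

theorem IsBounded.reindex {G : Sig 𝕋 ι → Sig 𝕋 κ} (hG : IsBounded G) (f : μ → κ) :
    IsBounded fun u r => G u (f r) :=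
  (isBounded_reindex f).comp hG

theorem isBounded_zero : IsBounded fun _ : Sig 𝕋 ι => (0 : Sig 𝕋 κ) :=
  isBounded_of_coord fun _ => ⟨0, fun _ => ⟨0, map_zero _, by simp⟩⟩

theorem IsBounded.add {G G' : Sig 𝕋 ι → Sig 𝕋 κ} (hG : IsBounded G) (hG' : IsBounded G') :
    IsBounded fun u => G u + G' u := by
  obtain ⟨a, ha, hG⟩ := hG
  obtain ⟨b, hb, hG'⟩ := hG'
  refine ⟨a + b, by positivity, fun u => ?_⟩
  obtain ⟨y, hy, hle⟩ := hG u
  obtain ⟨y', hy', hle'⟩ := hG' u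
  refine ⟨y + y', by rw [map_add, hy, hy'], (norm_add_le _ _).trans ?_⟩
  rw [add_mul]
  exact add_le_add hle hle'

theorem IsBounded.sub {G G' : Sig 𝕋 ι → Sig 𝕋 κ} (hG : IsBounded G) (hG' : IsBounded G') :
    IsBounded fun u => G u - G' u := by
  obtain ⟨a, ha, hG⟩ := hG
  obtain ⟨b, hb, hG'⟩ := hG'
  refine ⟨a + b, by positivity, fun u => ?_⟩
  obtain ⟨y, hy, hle⟩ := hG u
  obtain ⟨y', hy', hle'⟩ := hG' u
  refine ⟨y - y', by rw [map_sub, hy, hy'], (norm_sub_le _ _).trans ?_⟩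
  rw [add_mul]
  exact add_le_add hle hle'

theorem IsBounded.sumElim {G : Sig 𝕋 ι → Sig 𝕋 κ} {G' : Sig 𝕋 ι → Sig 𝕋 μ} (hG : IsBounded G)
    (hG' : IsBounded G') : IsBounded fun u => (Sum.elim (G u) (G' u) : Sig 𝕋 (κ ⊕ μ)) := by
  rw [isBounded_coord_iff] at *
  rintro (r | r)
  · exact hG r
  · exact hG' r

end Combinators

/-! ### Inverses of bijective operators. -/

section SigInv

variable {𝕋 : TimeDomain} {ι : Type} {A : Module.End ℝ (Sig 𝕋 ι)}

theorem apply_sigInv (hA : Function.Bijective A) (v : Sig 𝕋 ι) : A (sigInv A v) = v :=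
  LinearMap.congr_fun (Ring.mul_inverse_cancel A ((Module.End.isUnit_iff A).2 hA)) v

theorem sigInv_apply (hA : Function.Bijective A) (v : Sig 𝕋 ι) : sigInv A (A v) = v :=
  LinearMap.congr_fun (Ring.inverse_mul_cancel A ((Module.End.isUnit_iff A).2 hA)) v

end SigInv

/-! ### Agents, fan-out and link deviations. -/

section Agents

variable {𝕋 : TimeDomain} {V : Type} {Γ : SimpleGraph V}

theorem fanOut_apply (w : Sig 𝕋 (Σ _ : V, Unit)) (r : Port Γ) :
    fanOut Γ w r = w ⟨r.1, ()⟩ := by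
  simp [fanOut, directSumLin, directSum, matSig, onesCol]

theorem isCausal_agents {H : ∀ i, Sig 𝕋 (Nbr Γ i) →ₗ[ℝ] Sig 𝕋 Unit}
    (hH : ∀ i, IsSystem (H i)) : IsCausal (agents H) :=
  isCausal_coord_iff.2 fun r =>
    (hH r.1).1.comp (isCausal_reindex fun a : Nbr Γ r.1 => (⟨r.1, a⟩ : Port Γ))

theorem isCausal_fanOut : IsCausal (fanOut Γ : Sig 𝕋 (Σ _ : V, Unit) → Sig 𝕋 (Port Γ)) := by
  rw [show (fanOut Γ : Sig 𝕋 (Σ _ : V, Unit) → Sig 𝕋 (Port Γ)) = fun w r => w ⟨r.1, ()⟩ from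
    funext fun w => funext (fanOut_apply w)]
  exact isCausal_reindex _

theorem isBounded_fanOut [Fintype V] [DecidableRel Γ.Adj] : IsBounded (fanOut Γ : Sig 𝕋 (Σ _ : V, Unit) → Sig 𝕋 (Port Γ)) := by
  rw [show (fanOut Γ : Sig 𝕋 (Σ _ : V, Unit) → Sig 𝕋 (Port Γ)) = fun w r => w ⟨r.1, ()⟩ from
    funext fun w => funext (fanOut_apply w)]
  exact isBounded_reindex _

theorem isCausal_delta_and_isBounded_delta [Fintype V] [DecidableRel Γ.Adj]
    {Λ : ∀ i, Nbr Γ i → Sig 𝕋 Unit → Sig 𝕋 Unit}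
    (hΛ : ∀ i k, IsStable (Λ i k)) : IsCausal (delta Λ) ∧ IsBounded (delta Λ) := by
  have h1 : IsCausal (links Λ) := isCausal_coord_iff.2 fun r =>
    (hΛ r.1 r.2).1.1.comp (isCausal_reindex fun _ => r)
  have h2 : IsBounded (links Λ) := isBounded_coord_iff.2 fun r =>
    (hΛ r.1 r.2).2.comp (isBounded_reindex fun _ => r)
  exact ⟨(h1.comp isCausal_fanOut).sub isCausal_fanOut,
    (h2.comp isBounded_fanOut).sub isBounded_fanOut⟩

end Agents

/-! ### Loop transformation and a priori bound. -/

section NetworkLoop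

variable {𝕋 : TimeDomain} {V : Type} [Fintype V] [LinearOrder V] {Γ : SimpleGraph V}
  [DecidableRel Γ.Adj]

theorem matSig_routing_apply (v : Sig 𝕋 (Port Γ)) (i : V) (j : Nbr Γ i) :
    matSig (routing Γ) v ⟨i, j⟩ = v ⟨j, ⟨i, Γ.adj_symm j.2⟩⟩ := by
  refine (Finset.sum_eq_single (⟨j, ⟨i, Γ.adj_symm j.2⟩⟩ : Port Γ) ?_ (by simp)).trans ?_
  · rintro ⟨a, b, hb⟩ _ hne
    have : ¬ (a = (j : V) ∧ b = i) := by
      rintro ⟨rfl, rfl⟩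
      exact hne rfl
    simp [routing, this]
  · simp [routing]

theorem matSig_routing_matSig_routing (v : Sig 𝕋 (Port Γ)) :
    matSig (routing Γ) (matSig (routing Γ) v) = v := by
  funext ⟨i, j⟩
  rw [matSig_routing_apply, matSig_routing_apply]

variable {H : ∀ i, Sig 𝕋 (Nbr Γ i) →ₗ[ℝ] Sig 𝕋 Unit}

variable (H) in
/-- The operator `P - T H` of the network with ideal links. -/
def loopOperator : Module.End ℝ (Sig 𝕋 (Port Γ)) :=
  matSig (routing Γ) - fanOut Γ ∘ₗ agents H

/-- If the network with ideal links is stable, then `P - T H` is bijective, and its inverse and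
its product with `T H` are stable. -/
theorem bijective_and_isBounded_sigInv
    (hideal : LoopStable (matSig (routing Γ) : Sig 𝕋 (Port Γ) → Sig 𝕋 (Port Γ))
      (fanOut Γ ∘ agents H)) :
    Function.Bijective (loopOperator H) ∧
    IsCausal (sigInv (loopOperator H)) ∧
    IsBounded (sigInv (loopOperator H)) ∧
    IsBounded (fanOut Γ ∘ nominal H) := by
  obtain ⟨S, hS, hc, hb⟩ := hideal
  set A := loopOperator H
  have hAv (v : Sig 𝕋 (Port Γ)) : A v = matSig (routing Γ) v - fanOut Γ (agents H v) := rfl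
  -- The ideal loop with disturbance `(P d, 0)` reads `y = P u + P d`, `u = T H y`, and applying `P`
  -- gives `(P - T H) y = d`. So `R d` consists of `(P - T H)⁻¹ d` and `T H (P - T H)⁻¹ d`.
  let R : Sig 𝕋 (Port Γ) → Sig 𝕋 (Port Γ ⊕ Port Γ) :=
    fun d => S (Sum.elim (matSig (routing Γ) d) 0)
  have hR (d : Sig 𝕋 (Port Γ)) : A (fun r => R d (Sum.inl r)) = d ∧
      (fun r => R d (Sum.inr r)) = fanOut Γ (agents H fun r => R d (Sum.inl r)) := by
    obtain ⟨h1, h2⟩ := (hS (matSig (routing Γ) d) 0 (fun r => R d (Sum.inl r))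
      (fun r => R d (Sum.inr r))).2 (by funext x; cases x <;> rfl)
    rw [add_zero] at h2
    refine ⟨?_, h2⟩
    have h3 := congrArg (matSig (routing Γ)) h1
    rw [map_add, matSig_routing_matSig_routing, matSig_routing_matSig_routing] at h3
    rw [hAv, h3, h2]
    exact add_sub_cancel_left _ _
  have hbij : Function.Bijective A := by
    refine ⟨(injective_iff_map_eq_zero A).2 fun v hv => ?_, fun d => ⟨_, (hR d).1⟩⟩
    have hv' : matSig (routing Γ) v = fanOut Γ (agents H v) := sub_eq_zero.1 hv
    -- A kernel element gives a solution of the undisturbed ideal loop, which is unique and hence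
    -- zero.
    have h1 := (hS 0 0 v (fanOut Γ (agents H v))).1
      ⟨by rw [← hv', matSig_routing_matSig_routing, add_zero], by simp⟩
    have h2 := (hS 0 0 0 0).1 ⟨by simp, by simp⟩
    have h3 := h1.trans h2.symm
    exact funext fun r => congrFun h3 (Sum.inl r)
  have hM : (sigInv A : Sig 𝕋 (Port Γ) → Sig 𝕋 (Port Γ)) = fun d r => R d (Sum.inl r) := by
    funext d
    exact hbij.1 ((apply_sigInv hbij d).trans (hR d).1.symm)
  have hRc : IsCausal R := hc.comp ((isCausal_matSig _).sumElim isCausal_zero)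
  have hRb : IsBounded R := hb.comp ((isBounded_matSig _).sumElim isBounded_zero)
  refine ⟨hbij, hM ▸ hRc.reindex Sum.inl, hM ▸ hRb.reindex Sum.inl, ?_⟩
  have hT : fanOut Γ ∘ nominal H = fun d r => R d (Sum.inr r) := by
    funext d
    refine Eq.trans ?_ (hR d).2.symm
    exact congrArg (fun v => fanOut Γ (agents H v)) (congrFun hM d)
  rw [hT]
  exact hRb.reindex Sum.inr

/-- The agents need not be bounded, so `G` is recovered from the bounded `T G` by reading each
agent's output at one of its ports. -/
theorem isBounded_nominal (hΓ : ∀ i : V, ∃ j, Γ.Adj i j)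
    (hb : IsBounded (fanOut Γ ∘ nominal H)) : IsBounded (nominal H) := by
  choose j hj using hΓ
  have := hb.reindex fun r : (Σ _ : V, Unit) => (⟨r.1, ⟨j r.1, hj r.1⟩⟩ : Port Γ)
  simpa only [Function.comp_apply, fanOut_apply] using this

/-- The closed-loop map of the uncertain network, in terms of the loop of the nominal network
and the deviation from ideal links. -/
theorem loopStable_of_closedLoop {Λ : ∀ i, Nbr Γ i → Sig 𝕋 Unit → Sig 𝕋 Unit}
    (hbij : Function.Bijective (loopOperator H))
    (hMc : IsCausal (sigInv (loopOperator H)))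
    (hMb : IsBounded (sigInv (loopOperator H)))
    {E : Sig 𝕋 (Port Γ) → Sig 𝕋 (Port Γ)} (hEc : IsCausal E) (hEb : IsBounded E)
    (hE : ∀ d e, e = delta Λ (nominal H e) + d ↔ e = E d) :
    LoopStable (matSig (routing Γ) : Sig 𝕋 (Port Γ) → Sig 𝕋 (Port Γ))
      (links Λ ∘ fanOut Γ ∘ agents H) := by
  set A := loopOperator H
  have hAv (v : Sig 𝕋 (Port Γ)) : A v = matSig (routing Γ) v - fanOut Γ (agents H v) := rfl
  have hnom (v : Sig 𝕋 (Port Γ)) : nominal H v = agents H (sigInv A v) := rfl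
  let d₁ : Sig 𝕋 (Port Γ ⊕ Port Γ) → Sig 𝕋 (Port Γ) := fun d r => d (Sum.inl r)
  let d₂ : Sig 𝕋 (Port Γ ⊕ Port Γ) → Sig 𝕋 (Port Γ) := fun d r => d (Sum.inr r)
  let Y : Sig 𝕋 (Port Γ ⊕ Port Γ) → Sig 𝕋 (Port Γ) := fun d =>
    sigInv A (E (d₂ d + matSig (routing Γ) (d₁ d)))
  have hYc : IsCausal Y := hMc.comp (hEc.comp
    ((isCausal_reindex _).add ((isCausal_matSig _).comp (isCausal_reindex _))))
  have hYb : IsBounded Y := hMb.comp (hEb.comp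
    ((isBounded_reindex _).add ((isBounded_matSig _).comp (isBounded_reindex _))))
  refine ⟨fun d => Sum.elim (Y d) (matSig (routing Γ) (Y d - d₁ d)), ?_,
    hYc.sumElim ((isCausal_matSig _).comp (hYc.sub (isCausal_reindex _))),
    hYb.sumElim ((isBounded_matSig _).comp (hYb.sub (isBounded_reindex _)))⟩
  intro dy du y u
  have hY : Y (Sum.elim dy du) = sigInv A (E (du + matSig (routing Γ) dy)) := rfl
  have hd : d₁ (Sum.elim dy du) = dy := rfl
  dsimp only
  rw [hY, hd]
  constructor
  · rintro ⟨h1, h2⟩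
    have h3 : matSig (routing Γ) y = u + matSig (routing Γ) dy := by
      conv_lhs => rw [h1]
      rw [map_add, matSig_routing_matSig_routing]
    -- The variable `e = (P - T H) y` satisfies `G e = H y`, and the loop equations become `e = Δ (G
    -- e) + d_u + P d_y`.
    have h4 : A y = E (du + matSig (routing Γ) dy) := by
      rw [← hE, hnom, sigInv_apply hbij, hAv, h3, h2, delta]
      simp only [Function.comp_apply]
      abel
    rw [← h4, sigInv_apply hbij, map_sub, h3, add_sub_cancel_right]
  · intro h
    have hy : y = sigInv A (E (du + matSig (routing Γ) dy)) :=
      funext fun r => congrFun h (Sum.inl r)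
    have hu : u = matSig (routing Γ) (sigInv A (E (du + matSig (routing Γ) dy)) - dy) :=
      funext fun r => congrFun h (Sum.inr r)
    rw [← hy] at hu
    refine ⟨by rw [hu, matSig_routing_matSig_routing, sub_add_cancel], ?_⟩
    have h4 := (hE (du + matSig (routing Γ) dy) _).2 rfl
    rw [hnom, ← hy, ← apply_sigInv hbij (E _), ← hy, hAv, delta, sub_eq_iff_eq_add] at h4
    rw [hu, map_sub, h4]
    simp only [Function.comp_apply]
    abel

variable {N : ∀ i, StableLinear 𝕋 (Nbr Γ i) Unit}
  {D : ∀ i, StableLinear 𝕋 (Nbr Γ i) (Nbr Γ i)}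
  {U : ∀ i, StableLinear 𝕋 Unit (Nbr Γ i)} {W : ∀ i, StableLinear 𝕋 (Nbr Γ i) (Nbr Γ i)}

/-- Finite energy pairs of inputs and outputs of the nominal network are images of finite energy
signals under the coprime factors. -/
theorem exists_coprime_image
    (hbij : Function.Bijective (loopOperator H))
    (hMb : IsBounded (sigInv (loopOperator H)))
    (hGb : IsBounded (nominal H))
    (hD : ∀ i, Function.Bijective (D i).map)
    (hfac : ∀ i, H i = (N i).map ∘ₗ sigInv (D i).map)
    (hcop : ∀ i, (U i).map ∘ₗ (N i).map + (W i).map ∘ₗ (D i).map = LinearMap.id)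
    (e : L2 𝕋 (Port Γ)) :
    ∃ z : L2 𝕋 (Port Γ), incl (directSumL2 (fun i => (N i).toL2) z) = nominal H (incl e) ∧
      e = directSumL2 (agentJ (fun i => (N i).toL2) fun i => (D i).toL2) z -
        (directSumL2 (fun i => (D i).toL2) z -
          matL2 (routing Γ) (directSumL2 (fun i => (D i).toL2) z)) := by
  obtain ⟨_, -, hMb⟩ := hMb
  obtain ⟨_, -, hGb⟩ := hGb
  obtain ⟨y, hy, -⟩ := hMb e
  obtain ⟨w, hw, -⟩ := hGb e
  set A := loopOperator H
  let x : ∀ i, Sig 𝕋 (Nbr Γ i) := fun i => sigInv (D i).map (incl (blockL2 i y))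
  have hxD (i : V) : (D i).map (x i) = incl (blockL2 i y) := apply_sigInv (hD i) _
  have hwy : incl w = agents H (incl y) := by rw [hw, hy]; rfl
  have hxN (i : V) : (N i).map (x i) = incl (blockL2 i w) := by
    have h1 : (N i).map (x i) = H i (incl (blockL2 i y)) := by rw [hfac]; rfl
    rw [h1]
    exact funext fun _ => (congrFun hwy ⟨i, ()⟩).symm
  -- The preimage `x i` of a block of `y` under `D i` is known only in the extended space. By the
  -- Bezout identity it equals `U N x + W D x`, built from the finite energy signals `w` and `y`.
  let z : L2 𝕋 (Port Γ) :=
    directSumL2 (fun i => (U i).toL2) w + directSumL2 (fun i => (W i).toL2) y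
  have hz (i : V) : incl (blockL2 i z) = x i := by
    have h1 : blockL2 i z = (U i).toL2 (blockL2 i w) + (W i).toL2 (blockL2 i y) := by
      rw [map_add, blockL2_directSumL2, blockL2_directSumL2]
    rw [h1, map_add, StableLinear.incl_toL2, StableLinear.incl_toL2, ← hxN, ← hxD]
    exact LinearMap.congr_fun (hcop i) (x i)
  have hzN (i : V) : (N i).toL2 (blockL2 i z) = blockL2 i w := incl_injective <| by
    rw [StableLinear.incl_toL2, hz, hxN]
  have hzD (i : V) : (D i).toL2 (blockL2 i z) = blockL2 i y := incl_injective <| by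
    rw [StableLinear.incl_toL2, hz, hxD]
  have hNz : directSumL2 (fun i => (N i).toL2) z = w := by
    ext1 r
    rw [directSumL2_apply, hzN]
    rfl
  have hDz : directSumL2 (fun i => (D i).toL2) z = y := by
    ext1 r
    rw [directSumL2_apply, hzD]
    rfl
  refine ⟨z, hNz ▸ hw, incl_injective ?_⟩
  have hJ : incl (directSumL2 (agentJ (fun i => (N i).toL2) fun i => (D i).toL2) z) =
      incl y - fanOut Γ (incl w) := by
    funext r
    have h1 : directSumL2 (agentJ (fun i => (N i).toL2) fun i => (D i).toL2) z r =
        y r - w ⟨r.1, ()⟩ := by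
      rw [directSumL2_apply, agentJ, sub_apply, ContinuousLinearMap.comp_apply, hzN, hzD,
        PiLp.sub_apply, matL2_apply]
      simp [onesCol]
    rw [Pi.sub_apply, fanOut_apply]
    exact (congrArg scalarIncl h1).trans (map_sub _ _ _)
  have he : A (incl y) = incl e := by rw [hy, apply_sigInv hbij]
  rw [map_sub, map_sub, hDz, hJ, incl_matL2, ← he, hwy]
  change matSig (routing Γ) (incl y) - fanOut Γ (agents H (incl y)) = _
  abel

/-- The a priori bound on the finite energy solutions of the scaled loops. -/
theorem exists_aprioriBound {Λ : ∀ i, Nbr Γ i → Sig 𝕋 Unit → Sig 𝕋 Unit}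
    (N : ∀ i, L2 𝕋 (Nbr Γ i) →L[ℝ] L2 𝕋 Unit)
    (D : ∀ i, L2 𝕋 (Nbr Γ i) →L[ℝ] L2 𝕋 (Nbr Γ i))
    (hz : ∀ e : L2 𝕋 (Port Γ), ∃ z : L2 𝕋 (Port Γ),
      incl (directSumL2 N z) = nominal H (incl e) ∧
      e = directSumL2 (agentJ N D) z -
        (directSumL2 D z - matL2 (routing Γ) (directSumL2 D z)))
    (Pi₁ : V → (L2 𝕋 Unit →L[ℝ] L2 𝕋 Unit))
    (Pi₂ : ∀ i, L2 𝕋 (Nbr Γ i) →L[ℝ] L2 𝕋 Unit)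
    (Pi₃ : ∀ i, L2 𝕋 (Nbr Γ i) →L[ℝ] L2 𝕋 (Nbr Γ i))
    (hIQC : ∀ i, ∀ a ∈ Set.Icc (0 : ℝ) 1, ∀ (y : L2 𝕋 Unit) (u : L2 𝕋 (Nbr Γ i)),
      incl u = a • agentDelta Λ i (incl y) → 0 ≤ blockForm (Pi₁ i) (Pi₂ i) (Pi₃ i) y u)
    {ε : ℝ} (hε : 0 < ε) (hnom : ∀ z : L2 𝕋 (Port Γ),
      ∑ i, blockForm (Pi₁ i) (Pi₂ i) (Pi₃ i) (N i (blockL2 i z))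
        (agentJ N D i (blockL2 i z) -
          blockL2 i (directSumL2 D z - matL2 (routing Γ) (directSumL2 D z))) ≤
        -ε * ‖z‖ ^ 2) :
    ∃ C : ℝ, ∀ a ∈ Set.Icc (0 : ℝ) 1, ∀ e d : L2 𝕋 (Port Γ),
      incl e = a • delta Λ (nominal H (incl e)) + incl d → ‖e‖ ≤ C * ‖d‖ := by
  choose K hK hsub using fun i => exists_blockForm_sub_le (Pi₁ i) (Pi₂ i) (Pi₃ i)
  let R : L2 𝕋 (Port Γ) →L[ℝ] L2 𝕋 (Port Γ) :=
    directSumL2 (agentJ N D) - (directSumL2 D - matL2 (routing Γ) ∘L directSumL2 D)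
  let N' : L2 𝕋 (Port Γ) →L[ℝ] L2 𝕋 (Σ _ : V, Unit) := directSumL2 N
  let k := ∑ i, K i
  have hk : 0 ≤ k := Finset.sum_nonneg fun i _ => hK i
  -- The summand `1` serves the case `‖z‖ ≤ ‖d‖`. Otherwise the lone `‖d‖` in the bracket of `hmain`
  -- is replaced by `‖z‖`, and one factor `‖z‖` cancels.
  let C := 1 + k * (‖N'‖ + ‖R‖ + 1) / ε
  refine ⟨‖R‖ * C, fun a ha e d hed => ?_⟩
  obtain ⟨z, hzN, hze⟩ := hz e
  have heR : e = R z := hze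
  -- The scaled deviation produces `e - d`, not `e`, and it acts agent by agent.
  have hu (i : V) : incl (blockL2 i (e - d)) = a • agentDelta Λ i (incl (blockL2 i (N' z))) := by
    have h1 : incl (e - d) = a • delta Λ (incl (N' z)) := by
      rw [map_sub, hed, add_sub_cancel_right, hzN]
    funext j
    exact congrFun h1 ⟨i, j⟩
  have h0 := Finset.sum_nonneg fun i (_ : i ∈ Finset.univ) =>
    (hIQC i a ha _ _ (hu i)).trans
      ((congrArg _ (map_sub (blockL2 i) e d)).trans_le (hsub i _ _ _))
  have hq : ∑ i, blockForm (Pi₁ i) (Pi₂ i) (Pi₃ i) (blockL2 i (N' z)) (blockL2 i e) ≤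
      -ε * ‖z‖ ^ 2 := by
    refine le_trans (le_of_eq (Finset.sum_congr rfl fun i _ => ?_)) (hnom z)
    conv_lhs => rw [hze, map_sub]
    rfl
  have hN : ‖N' z‖ ≤ ‖N'‖ * ‖z‖ := N'.le_opNorm z
  have hR : ‖e‖ ≤ ‖R‖ * ‖z‖ := heR ▸ R.le_opNorm z
  have hc : ∑ i, K i * ((‖blockL2 i (N' z)‖ + ‖blockL2 i e‖ + ‖blockL2 i d‖) * ‖blockL2 i d‖) ≤
      k * ((‖N'‖ * ‖z‖ + ‖R‖ * ‖z‖ + ‖d‖) * ‖d‖) := by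
    rw [Finset.sum_mul]
    refine Finset.sum_le_sum fun i _ => mul_le_mul_of_nonneg_left ?_ (hK i)
    have h1 := (norm_blockL2_le (N' z) i).trans hN
    have h2 := (norm_blockL2_le e i).trans hR
    have h3 := norm_blockL2_le d i
    gcongr
  rw [Finset.sum_add_distrib] at h0
  have hmain : ε * ‖z‖ ^ 2 ≤ k * ((‖N'‖ * ‖z‖ + ‖R‖ * ‖z‖ + ‖d‖) * ‖d‖) := by linarith
  have hzd : ‖z‖ ≤ C * ‖d‖ := by
    have hC : 0 ≤ k * (‖N'‖ + ‖R‖ + 1) / ε := by positivity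
    rcases le_or_gt ‖z‖ ‖d‖ with h | h
    · refine h.trans (le_mul_of_one_le_left (norm_nonneg d) ?_)
      exact le_add_of_nonneg_right hC
    · have hz0 : 0 < ‖z‖ := (norm_nonneg d).trans_lt h
      have h1 : ‖z‖ * (ε * ‖z‖) ≤ ‖z‖ * (k * (‖N'‖ + ‖R‖ + 1) * ‖d‖) := by
        calc ‖z‖ * (ε * ‖z‖) = ε * ‖z‖ ^ 2 := by ring
          _ ≤ k * ((‖N'‖ * ‖z‖ + ‖R‖ * ‖z‖ + ‖d‖) * ‖d‖) := hmain
          _ ≤ k * ((‖N'‖ * ‖z‖ + ‖R‖ * ‖z‖ + ‖z‖) * ‖d‖) := by gcongr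
          _ = _ := by ring
      have h2 := le_of_mul_le_mul_left h1 hz0
      have h3 : ‖z‖ ≤ k * (‖N'‖ + ‖R‖ + 1) / ε * ‖d‖ := by
        rw [div_mul_eq_mul_div, le_div_iff₀ hε]
        linarith
      refine h3.trans (mul_le_mul_of_nonneg_right ?_ (norm_nonneg d))
      exact le_add_of_nonneg_left zero_le_one
  calc ‖e‖ ≤ ‖R‖ * ‖z‖ := hR
    _ ≤ ‖R‖ * (C * ‖d‖) := by gcongr
    _ = _ := by ring

end NetworkLoop

end LinkNet

end

/-! ### The stability theorem. -/

theorem theorem4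
    -- time axis, network graph
    (𝕋 : LinkNet.TimeDomain) (n : ℕ) (hn : 2 ≤ n)
    (Γ : SimpleGraph (Fin n)) [DecidableRel Γ.Adj] (hΓ : Γ.Connected)
    -- linear agents, stable links
    (H : ∀ i, LinkNet.Sig 𝕋 (LinkNet.Nbr Γ i) →ₗ[ℝ] LinkNet.Sig 𝕋 Unit)
    (hH : ∀ i, LinkNet.IsSystem (H i))
    (Λ : ∀ i, LinkNet.Nbr Γ i → LinkNet.Sig 𝕋 Unit → LinkNet.Sig 𝕋 Unit)
    (hΛ : ∀ i k, LinkNet.IsStable (Λ i k))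
    -- the network with ideal links is stable
    (hideal : LinkNet.LoopStable (LinkNet.matSig (LinkNet.routing Γ) :
        LinkNet.Sig 𝕋 (LinkNet.Port Γ) → LinkNet.Sig 𝕋 (LinkNet.Port Γ))
      (LinkNet.fanOut Γ ∘ LinkNet.agents H))
    -- well-posedness of the loops with scaled link uncertainty
    (hwp : ∀ a ∈ Set.Icc (0 : ℝ) 1,
      LinkNet.LoopWellPosed (LinkNet.nominal H) (fun y => a • LinkNet.delta Λ y))
    -- coprime factorizations of the agents
    (N : ∀ i, LinkNet.StableLinear 𝕋 (LinkNet.Nbr Γ i) Unit)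
    (D : ∀ i, LinkNet.StableLinear 𝕋 (LinkNet.Nbr Γ i) (LinkNet.Nbr Γ i))
    (U : ∀ i, LinkNet.StableLinear 𝕋 Unit (LinkNet.Nbr Γ i))
    (W : ∀ i, LinkNet.StableLinear 𝕋 (LinkNet.Nbr Γ i) (LinkNet.Nbr Γ i))
    (hD : ∀ i, Function.Bijective (D i).map)
    (hfac : ∀ i, H i = (N i).map ∘ₗ LinkNet.sigInv (D i).map)
    (hcop : ∀ i, (U i).map ∘ₗ (N i).map + (W i).map ∘ₗ (D i).map = LinearMap.id)
    -- integral quadratic constraints on the link uncertainty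
    (Pi₁ : Fin n → (LinkNet.L2 𝕋 Unit →L[ℝ] LinkNet.L2 𝕋 Unit))
    (Pi₂ : ∀ i, LinkNet.L2 𝕋 (LinkNet.Nbr Γ i) →L[ℝ] LinkNet.L2 𝕋 Unit)
    (Pi₃ : ∀ i, LinkNet.L2 𝕋 (LinkNet.Nbr Γ i) →L[ℝ] LinkNet.L2 𝕋 (LinkNet.Nbr Γ i))
    (hPi₁ : ∀ i, IsSelfAdjoint (Pi₁ i)) (hPi₃ : ∀ i, IsSelfAdjoint (Pi₃ i))
    (hIQC : ∀ i, ∀ a ∈ Set.Icc (0 : ℝ) 1, ∀ (y : LinkNet.L2 𝕋 Unit)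
      (u : LinkNet.L2 𝕋 (LinkNet.Nbr Γ i)),
      LinkNet.incl u = a • LinkNet.agentDelta Λ i (LinkNet.incl y) →
        0 ≤ LinkNet.blockForm (Pi₁ i) (Pi₂ i) (Pi₃ i) y u)
    -- the localized edge partition
    (c : ℕ) (F : Fin c → Finset (Sym2 (Fin n)))
    (hF : LinkNet.IsLocalizedEdgePartition Γ F)
    (hcov : LinkNet.CoversAdjacentEdges Γ F)
    -- the local integral quadratic constraints
    (hloc : ∀ p, LinkNet.LocalIQC F p (fun i => (N i).toL2) (fun i => (D i).toL2) Pi₁ Pi₂ Pi₃) :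
    LinkNet.LoopStable (LinkNet.matSig (LinkNet.routing Γ) :
        LinkNet.Sig 𝕋 (LinkNet.Port Γ) → LinkNet.Sig 𝕋 (LinkNet.Port Γ))
      (LinkNet.links Λ ∘ LinkNet.fanOut Γ ∘ LinkNet.agents H) := by
  have : Nontrivial (Fin n) := Fin.nontrivial_iff_two_le.2 hn
  -- A connected graph on at least two vertices has no isolated vertex.
  have hadj : ∀ i, ∃ j, Γ.Adj i j := fun i =>
    (Γ.degree_pos_iff_exists_adj i).1 (hΓ.preconnected.degree_pos_of_nontrivial i)
  obtain ⟨hbij, hMc, hMb, hTb⟩ := LinkNet.bijective_and_isBounded_sigInv hideal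
  have hGb := LinkNet.isBounded_nominal hadj hTb
  have hGc : LinkNet.IsCausal (LinkNet.nominal H) := (LinkNet.isCausal_agents hH).comp hMc
  obtain ⟨hΔc, hΔb⟩ := LinkNet.isCausal_delta_and_isBounded_delta hΛ
  obtain ⟨ε, hε, hnom⟩ :=
    LinkNet.exists_sum_blockForm_le hF hcov hadj _ _ Pi₁ Pi₂ Pi₃ hPi₃ hloc
  obtain ⟨C, hC⟩ := LinkNet.exists_aprioriBound (H := H) _ _
    (LinkNet.exists_coprime_image hbij hMb hGb hD hfac hcop) Pi₁ Pi₂ Pi₃ hIQC hε hnom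
  -- The end point `α = 1` of the homotopy is the true deviation.
  obtain ⟨E, hEc, hE⟩ := (hwp 1 (by simp)).exists_closedLoop
  simp only [one_smul] at hE
  refine LinkNet.loopStable_of_closedLoop hbij hMc hMb hEc
    ⟨|C| + 1, by positivity, fun d => ?_⟩ hE
  obtain ⟨e, he, hle⟩ := LinkNet.exists_incl_of_aprioriBound hGc hGb hΔc hΔb hwp hC d
  refine ⟨e, (hE _ _).1 he, hle.trans (mul_le_mul_of_nonneg_right ?_ (norm_nonneg d))⟩
  linarith [le_abs_self C]
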